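/- Let $d\ge 1$ be an integer, $T>0$, and $\alpha>\max\{0,d-2\}$ a real number. Write $\mathcal F S$ for the Fourier transform of a tempered distribution $S$ on $\mathbb R^d$ (with kernel $(2\pi)^{-d/2}e^{-i\xi\cdot x}$ on functions), and for $\gamma\in\mathbb R$ let $$H_2^\gamma(\mathbb R^d)=\Big\{S\in\mathcal S'(\mathbb R^d):\ \mathcal F S\text{ is a function},\ \|S\|_{\gamma,2}^2=\int_{\mathbb R^d}|\mathcal F S(\xi)|^2(1+|\xi|^2)^{\gamma}\,d\xi<\infty\Big\}.$$ Let $B_\alpha(x)=\frac{1}{(4\pi)^{d/2}\Gamma(\alpha/2)}\int_0^\infty\tau^{(\alpha-d)/2-1}e^{-\tau-|x|^2/(4\tau)}\,d\tau$ be the Bessel kernel of order $\alpha$, so that $(1-\Delta)^{-\alpha/2}\psi=\psi*B_\alpha$ for Schwartz functions $\psi$. *Noise and integrands.* Let $F=\{F(\psi):\psi\in\mathcal D((0,T)\times\mathbb R^d)\}$ be a zero-mean Gaussian process, indexed by real test functions, with $$E(F(\psi)F(\eta))=\int_0^T\!\!\int_{\mathbb R^d}\!\int_{\mathbb R^d}\psi(t,x)B_\alpha(x-y)\eta(t,y)\,dy\,dx\,dt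 .$$ Let $\overline{\mathcal P}^{(d)}$ be the set of maps $\varphi:[0,T]\to\mathcal S'(\mathbb R^d)$ such that $\mathcal F\varphi(t,\cdot)$ is a function for every $t$, $(t,\xi)\mapsto\mathcal F\varphi(t,\xi)$ is measurable, and $\|\varphi\|_0^2=\int_0^T\int_{\mathbb R^d}|\mathcal F\varphi(t,\xi)|^2(1+|\xi|^2)^{-\alpha/2}\,d\xi\,dt<\infty$. Let $\mathcal E_0^{(d)}$ be the set of measurable $\psi:[0,T]\times\mathbb R^d\to\mathbb R$ with $\psi(t,\cdot)\in\mathcal S(\mathbb R^d)$ for all $t\in[0,T]$ and $\int_0^T\int\int|\psi(t,x)|B_\alpha(x-y)|\psi(t,y)|\,dy\,dx\,dt<\infty$, and let $\mathcal P_0^{(d)}$ be the closure of $\mathcal E_0^{(d)}$ in $\overline{\mathcal P}^{(d)}$ with respect to $\|\cdot\|_0$. For $\varphi\in\mathcal P_0^{(d)}$ let $M(\varphi)$ be the stochastic integral of $\varphi$: the limit in $L_2(\Omega)$ of $F(\varphi_n)$ for any test functions $\varphi_n\in\mathcal D((0,T)\times\mathbb R^d)$ with $\|\varphi_n-\varphi\|_0\to0$.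 With $G(t,x)=(4\pi t)^{-d/2}e^{-|x|^2/(4t)}$ for $t>0$ and $G(t,x)=0$ for $t\le0$, let $u(t,x)=M(g_{tx})$, $g_{tx}(s,y)=G(t-s,x-y)$, be the process solution of $u_t-\Delta u=\dot F$ in $(0,T)\times\mathbb R^d$, $u(0,\cdot)=0$. *Solutions.* A map $v:[0,T]\to\mathcal S'(\mathbb R^d)$ with values in some $H_2^{\beta}(\mathbb R^d)$, $\beta\in\mathbb R$, is a solution of $dv=(\Delta v+g)\,dt$ in $(0,T)\times\mathbb R^d$, $v(0,\cdot)=0$, if $v(0,\cdot)=0$ and, for all $t\in(0,T)$ and all $\psi\in\mathcal D(\mathbb R^d)$, $$(v(t,\cdot),\psi)=\int_0^t(v(s,\cdot),\Delta\psi)\,ds+\int_0^t(g(s,\cdot),\psi)\,ds$$ (the integrands being integrable). The space $\mathcal H^{\gamma}_{2,0}(T)$ consists of those $v$ with $v(t,\cdot)\in H_2^\gamma(\mathbb R^d)$ for almost every $t\in(0,T)$ and $v_{x_ix_j}\in L_2((0,T),H_2^{\gamma-2}(\mathbb R^d))$ for all $i,j$, which are solutions of $dv=(\Delta v+g)\,dt$,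 $v(0,\cdot)=0$, for some $g\in L_2((0,T),H_2^{\gamma-2}(\mathbb R^d))$. **Theorem.** Let $\varphi\in\mathcal P_0^{(d)}$, let $h(t,x)=E(M(\varphi)u(t,x))$ for $(t,x)\in[0,T]\times\mathbb R^d$, and set $\varphi_1(t,\cdot)=(1-\Delta)^{-\alpha/2}\varphi(t,\cdot)$. Then each $h(t,\cdot)$, $t\in[0,T]$, defines a tempered distribution, and $h$ is the unique solution in $\mathcal H^{\alpha/2+2}_{2,0}(T)$ of $$dh=(\Delta h+\varphi_1)\,dt\ \text{ in }(0,T)\times\mathbb R^d,\qquad h(0,\cdot)=0;$$ that is, $h\in\mathcal H^{\alpha/2+2}_{2,0}(T)$, $h$ is a solution, and every solution $w\in\mathcal H^{\alpha/2+2}_{2,0}(T)$ satisfies $w(t,\cdot)=h(t,\cdot)$ for all $t\in[0,T)$. -/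

import Mathlib

open MeasureTheory ProbabilityTheory Set Filter Topology
open scoped SchwartzMap FourierTransform LineDeriv Laplacian Distributions ENNReal

noncomputable section

namespace BesselHeat

/-- The space `ℝ^d` with its Euclidean norm. -/
abbrev Rd (d : ℕ) : Type := EuclideanSpace ℝ (Fin d)

/-- Complex tempered distributions on `ℝ^d`. -/
abbrev TD (d : ℕ) : Type := 𝓢'(Rd d, ℂ)

/-- The open strip `(0,T) × ℝ^d`. -/
def strip (d : ℕ) (T : ℝ) : TopologicalSpace.Opens (ℝ × Rd d) :=
  ⟨Ioo 0 T ×ˢ univ, isOpen_Ioo.prod isOpen_univ⟩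

/-! ### Distributions given by functions -/

/-- The tempered distribution `S` is (integration against) the function `f`. -/
def IsDensity {d : ℕ} (S : TD d) (f : Rd d → ℂ) : Prop :=
  ∀ ψ : 𝓢(Rd d, ℂ), Integrable (fun x => ψ x * f x) ∧ S ψ = ∫ x, ψ x * f x

open Classical in
/-- The tempered distribution given by a function `f`
(and `0` if `f` does not define a tempered distribution). -/
def funDist {d : ℕ} (f : Rd d → ℂ) : TD d :=
  if h : ∃ S : TD d, IsDensity S f then h.choose else 0

/-- The Fourier transform of `S` is the locally integrable function `g`. The convention is that of
Mathlib, with kernel `exp (-2πi ⟪x, ξ⟫)`. -/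
def IsFourierDensity {d : ℕ} (S : TD d) (g : Rd d → ℂ) : Prop :=
  LocallyIntegrable g volume ∧
    ∀ ψ : 𝓢(Rd d, ℂ), HasCompactSupport ψ → (𝓕 S) ψ = ∫ ξ, ψ ξ * g ξ

/-! ### The spaces `H_2^γ(ℝ^d)` and `L_2((0,T), H_2^γ(ℝ^d))` -/

/-- The square of the norm of `H_2^γ(ℝ^d)`:
`‖S‖² = ∫ |ℱS(ξ)|² (1+|ξ|²)^γ dξ` with `ℱ` the unitary Fourier transform with kernel
`(2π)^{-d/2} exp (-i⟪x, ξ⟫)`. The substitution `ξ ↦ 2πξ` turns this into the integral below, for the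
Fourier transform with kernel `exp (-2πi⟪x, ξ⟫)`.
A function representing `ℱS` is unique almost everywhere, so the infimum is over one number, or over
nothing if `ℱS` is not a function; the value is then `∞`. -/
def sobolevSq {d : ℕ} (γ : ℝ) (S : TD d) : ℝ≥0∞ :=
  ⨅ (g : Rd d → ℂ) (_ : IsFourierDensity S g),
    ∫⁻ ξ, ‖g ξ‖ₑ ^ 2 * ENNReal.ofReal ((1 + (2 * Real.pi) ^ 2 * ‖ξ‖ ^ 2) ^ γ)

/-- The fractional Sobolev space `H_2^γ(ℝ^d)`. -/
def Sobolev (d : ℕ) (γ : ℝ) : Set (TD d) := {S | sobolevSq γ S < ∞}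

/-- `g ∈ L_2((0,T), H_2^γ(ℝ^d))`. Measurability of `g` is joint measurability of its Fourier
transform. -/
def MemL2Sobolev {d : ℕ} (γ T : ℝ) (g : ℝ → TD d) : Prop :=
  (∃ k : ℝ → Rd d → ℂ,
    AEMeasurable (fun p : ℝ × Rd d => k p.1 p.2) ((volume.restrict (Ioo 0 T)).prod volume) ∧
    ∀ᵐ t ∂(volume.restrict (Ioo 0 T)), IsFourierDensity (g t) (k t)) ∧
  ∫⁻ t in Ioo 0 T, sobolevSq γ (g t) < ∞

/-- The operator `(1-Δ)^{s/2}` on tempered distributions. Its symbol is `(1+|2πξ|²)^{s/2}` for the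
Fourier transform with kernel `exp (-2πi⟪x, ξ⟫)`. -/
def oneSubLaplacianPow {d : ℕ} (s : ℝ) : TD d →L[ℂ] TD d :=
  TemperedDistribution.fourierMultiplierCLM ℂ
    (fun ξ : Rd d => (((1 + (2 * Real.pi) ^ 2 * ‖ξ‖ ^ 2) ^ (s / 2) : ℝ) : ℂ))

/-! ### The noise -/

/-- The Bessel kernel `B_α`, normalized so that `(1-Δ)^{-α/2} ψ = ψ * B_α`. -/
def besselKernel (d : ℕ) (α : ℝ) (x : Rd d) : ℝ :=
  ((4 * Real.pi) ^ ((d : ℝ) / 2) * Real.Gamma (α / 2))⁻¹ *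
    ∫ τ in Ioi (0 : ℝ), τ ^ ((α - d) / 2 - 1) * Real.exp (-τ - ‖x‖ ^ 2 / (4 * τ))

/-- The covariance `∫_0^T ∫ ∫ φ(t,x) f(x-y) ψ(t,y) dy dx dt`. -/
def noiseCov {d : ℕ} (f : Rd d → ℝ) (T : ℝ) (φ ψ : 𝓓(strip d T, ℝ)) : ℝ :=
  ∫ t in Ioo 0 T, ∫ x, ∫ y, φ (t, x) * f (x - y) * ψ (t, y)

/-- `F` is a zero-mean Gaussian process, indexed by the real test functions on `(0,T) × ℝ^d`, with
covariance `noiseCov f T`. -/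
structure IsGaussianNoise {d : ℕ} (f : Rd d → ℝ) (T : ℝ) {Ω : Type*} [MeasurableSpace Ω]
    (P : Measure Ω) (F : 𝓓(strip d T, ℝ) → Ω → ℝ) : Prop where
  gaussian : IsGaussianProcess F P
  mean_zero : ∀ φ, ∫ ω, F φ ω ∂P = 0
  covariance : ∀ φ ψ, ∫ ω, F φ ω * F ψ ω ∂P = noiseCov f T φ ψ

/-! ### The space of integrands -/

/-- The square of the norm `‖·‖_0` for the Bessel kernel of order `α`, that is
`∫_0^T ∫ |ℱφ(t,ξ)|² (1+|ξ|²)^{-α/2} dξ dt`. -/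
def normZeroSq {d : ℕ} (α T : ℝ) (φ : ℝ → TD d) : ℝ≥0∞ :=
  ∫⁻ t in Icc 0 T, sobolevSq (-α / 2) (φ t)

/-- The distribution-valued function `t ↦ φ(t,·)` of a real function `φ`. -/
def slices {d : ℕ} (φ : ℝ → Rd d → ℝ) : ℝ → TD d :=
  fun t => funDist (fun x => (φ t x : ℂ))

/-- The square of the norm `‖·‖_+`. -/
def normPlusSq {d : ℕ} (f : Rd d → ℝ) (T : ℝ) (φ : ℝ → Rd d → ℝ) : ℝ≥0∞ :=
  ∫⁻ t in Icc 0 T, ∫⁻ x, ∫⁻ y, ENNReal.ofReal (|φ t x| * f (x - y) * |φ t y|)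

/-- The class `P_+^{(d)}` of measurable functions with `‖φ‖_+ < ∞`. -/
def PPlus {d : ℕ} (f : Rd d → ℝ) (T : ℝ) : Set (ℝ → Rd d → ℝ) :=
  {φ | Measurable (fun p : ℝ × Rd d => φ p.1 p.2) ∧ normPlusSq f T φ < ∞}

/-- The class `E_0^{(d)}` of those `φ ∈ P_+^{(d)}` for which every `φ(t,·)` is a Schwartz
function. -/
def EZero {d : ℕ} (f : Rd d → ℝ) (T : ℝ) : Set (ℝ → Rd d → ℝ) :=
  {φ | φ ∈ PPlus f T ∧ ∀ t ∈ Icc 0 T, ∃ s : 𝓢(Rd d, ℝ), ∀ x, s x = φ t x}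

/-- The class `P̄^{(d)}`, for the Bessel kernel of order `α`. -/
def PBar (d : ℕ) (α T : ℝ) : Set (ℝ → TD d) :=
  {φ | (∃ k : ℝ → Rd d → ℂ,
      AEMeasurable (fun p : ℝ × Rd d => k p.1 p.2) ((volume.restrict (Icc 0 T)).prod volume) ∧
      ∀ t ∈ Icc 0 T, IsFourierDensity (φ t) (k t)) ∧
    normZeroSq α T φ < ∞}

/-- The class `P_0^{(d)}`, for the Bessel kernel of order `α`: the closure of `E_0^{(d)}` in
`P̄^{(d)}` with respect to `‖·‖_0`. -/
def PZero (d : ℕ) (α T : ℝ) : Set (ℝ → TD d) :=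
  {φ | φ ∈ PBar d α T ∧ ∀ ε : ℝ≥0∞, 0 < ε →
    ∃ ψ ∈ EZero (besselKernel d α) T, normZeroSq α T (fun t => φ t - slices ψ t) < ε}

/-! ### The stochastic integral, the process solution and the function `h` -/

/-- `Y` is a version of the stochastic integral `M(φ)`: it is the limit in `L_2(Ω)` of `F(φ_n)` for
test functions `φ_n` with `‖φ_n - φ‖_0 → 0`. -/
def IsStochInt {d : ℕ} (α T : ℝ) {Ω : Type*} [MeasurableSpace Ω] (P : Measure Ω)
    (F : 𝓓(strip d T, ℝ) → Ω → ℝ) (φ : ℝ → TD d) (Y : Ω → ℝ) : Prop :=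
  MemLp Y 2 P ∧ ∃ φn : ℕ → 𝓓(strip d T, ℝ),
    Tendsto (fun n => normZeroSq α T (fun t => slices (fun s x => φn n (s, x)) t - φ t))
      atTop (𝓝 0) ∧
    Tendsto (fun n => eLpNorm (fun ω => F (φn n) ω - Y ω) 2 P) atTop (𝓝 0)

open Classical in
/-- The stochastic integral `M(φ)`, the continuous extension of `F` from test functions to
`P_0^{(d)}` (and `0` if there is no limit). -/
def stochInt {d : ℕ} (α T : ℝ) {Ω : Type*} [MeasurableSpace Ω] (P : Measure Ω)
    (F : 𝓓(strip d T, ℝ) → Ω → ℝ) (φ : ℝ → TD d) : Ω → ℝ :=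
  if h : ∃ Y : Ω → ℝ, IsStochInt α T P F φ Y then h.choose else 0

/-- The fundamental solution of the heat equation `u_t = Δu`. -/
def heatKernel {d : ℕ} (t : ℝ) (x : Rd d) : ℝ :=
  if 0 < t then (4 * Real.pi * t) ^ (-(d : ℝ) / 2) * Real.exp (-‖x‖ ^ 2 / (4 * t)) else 0

/-- The process solution `u(t,x) = M((s,y) ↦ G(t-s,x-y))` of the stochastic heat equation with
vanishing initial condition. -/
def processSolution {d : ℕ} (α T : ℝ) {Ω : Type*} [MeasurableSpace Ω] (P : Measure Ω)
    (F : 𝓓(strip d T, ℝ) → Ω → ℝ) (t : ℝ) (x : Rd d) : Ω → ℝ :=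
  stochInt α T P F (slices (fun s y => heatKernel (t - s) (x - y)))

/-- The function `h(t,x) = E(M(φ) u(t,x))`. -/
def hFun {d : ℕ} (α T : ℝ) {Ω : Type*} [MeasurableSpace Ω] (P : Measure Ω)
    (F : 𝓓(strip d T, ℝ) → Ω → ℝ) (φ : ℝ → TD d) (t : ℝ) (x : Rd d) : ℝ :=
  ∫ ω, stochInt α T P F φ ω * processSolution α T P F t x ω ∂P

/-! ### Solutions of `dv = (Δv + g) dt` and the space `ℋ_{2,0}^γ(T)` -/

/-- `v : [0,T] → H_2^β(ℝ^d)`, for some real `β`, is a solution of `dv = (Δv + g) dt` in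
`(0,T) × ℝ^d`, `v(0,·) = 0`. Complex test functions of compact support are used; as they are closed
under conjugation, it does not matter whether the pairing conjugates them. -/
def IsSolution {d : ℕ} (T : ℝ) (v g : ℝ → TD d) : Prop :=
  (∃ β : ℝ, ∀ t ∈ Icc 0 T, v t ∈ Sobolev d β) ∧ v 0 = 0 ∧
  ∀ t ∈ Ioo 0 T, ∀ ψ : 𝓢(Rd d, ℂ), HasCompactSupport ψ →
    IntegrableOn (fun s => v s (Δ ψ)) (Ioo 0 t) ∧ IntegrableOn (fun s => g s ψ) (Ioo 0 t) ∧
    v t ψ = (∫ s in Ioo 0 t, v s (Δ ψ)) + ∫ s in Ioo 0 t, g s ψ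

/-- The space `ℋ_{2,0}^γ(T)`: `v(t,·) ∈ H_2^γ(ℝ^d)` for almost every `t`, all second derivatives of
`v` in `x` are in `L_2((0,T), H_2^{γ-2}(ℝ^d))`, and `v` solves `dv = (Δv + g) dt`, `v(0,·) = 0`, for
some `g ∈ L_2((0,T), H_2^{γ-2}(ℝ^d))`. -/
def KrylovSpace (d : ℕ) (γ T : ℝ) : Set (ℝ → TD d) :=
  {v | (∀ᵐ t ∂(volume.restrict (Ioo 0 T)), v t ∈ Sobolev d γ) ∧
    (∀ i j : Fin d, MemL2Sobolev (γ - 2) T (fun t =>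
      ∂_{(EuclideanSpace.single i (1 : ℝ) : Rd d)}
        (∂_{(EuclideanSpace.single j (1 : ℝ) : Rd d)} (v t)))) ∧
    ∃ g : ℝ → TD d, MemL2Sobolev (γ - 2) T g ∧ IsSolution T v g}

end BesselHeat

end

/-! Everything is computed on the Fourier side. Subordination writes the Bessel kernel as a
Gamma-weighted superposition of heat kernels, so its Fourier transform is `symb ξ ^ (-α / 2)`
(`fourier_besselKernel`). Hence the covariance of the noise is the inner product of the Fourier
transforms of the test functions in a weighted `L²` over `[0,T] × ℝ^d` (`noiseCov_eq_inner`), and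
the stochastic integral inherits this isometry on limits of test functions
(`integral_stochInt_mul`). Elements of `PZero` are such limits. So are the heat kernels `g_{tx}`:
integrating their squared transforms in time gains a factor `symb ξ ^ (-1)`, and `symb ξ ^ (-(α / 2
+ 1))` is integrable because `α > d - 2`.

The transform of `g_{tx}(s)` is the character `exp(-2πi⟪x, ξ⟫)` times `exp(-4π²|ξ|²(t-s))`.
Inserting it into the isometry shows that `h(t,x)` is the inverse Fourier transform, at `x`, of the
Duhamel integral over `s < t` of `exp(-4π²|ξ|²(t-s))` times the transform of `(1-Δ)^{-α/2} φ(s)`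
(`hFun_eq_fourierInv`). For almost every `ξ` this integral solves a scalar linear ODE in integrated
form (`duhamel_eq`). Pairing with a test function and Fubini give the heat equation. Regularity is a
Schur test in time: the kernel has mass at most `e^T / symb ξ` in either variable, so two
derivatives are gained in `L²` (`lintegral_weightedSq_duhamel_le`). The inhomogeneity lies in
`L²(H^{α/2})`, which puts `h` at order `α/2 + 2`.

For uniqueness, let `u` be the difference of two solutions. The equation says that the transform `W`
of `u` is the time primitive of the transform `L` of `Δu`, while `L = -4π²|ξ|² W` almost everywhere.
For almost every `ξ` this is a homogeneous linear ODE with zero initial value, and Gronwall gives `W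
= 0` at all times (`eq_zero_of_heat`). -/

/-! ### Density of compactly supported Schwartz functions -/

section
variable {E F : Type*} [NormedAddCommGroup E] [NormedSpace ℝ E]
  [NormedAddCommGroup F] [NormedSpace ℝ F]

/-- Cutting off a Schwartz function far away from the origin changes it little. -/
theorem SchwartzMap.exists_seminorm_sub_cutoff_le (χ : 𝓢(E, F)) (ρ : E → ℝ)
    (hρ : ContDiff ℝ (⊤ : ℕ∞) ρ) (hc : HasCompactSupport ρ) (h1 : ∀ x, ‖x‖ < 1 → ρ x = 1) (k m : ℕ) :
    ∃ C : ℝ, ∀ ε : ℝ, 0 < ε → ε ≤ 1 → ∀ f : 𝓢(E, F), (∀ x, f x = ρ (ε • x) • χ x) →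
      SchwartzMap.seminorm ℝ k m (χ - f) ≤ C * ε := by
  have hσ : ContDiff ℝ (⊤ : ℕ∞) (fun x => 1 - ρ x) := contDiff_const.sub hρ
  have hbd : ∀ i : ℕ, ∃ C : ℝ, 0 ≤ C ∧ ∀ x, ‖iteratedFDeriv ℝ i (fun x => 1 - ρ x) x‖ ≤ C := by
    intro i
    obtain ⟨C, hC⟩ := (hc.iteratedFDeriv (𝕜 := ℝ) i).exists_bound_of_continuous
      ((hρ.of_le (mod_cast le_top)).continuous_iteratedFDeriv')
    refine ⟨1 + C, ?_, fun x => ?_⟩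
    · linarith [(norm_nonneg _).trans (hC 0)]
    have : iteratedFDeriv ℝ i (fun x => 1 - ρ x) x
        = iteratedFDeriv ℝ i (fun _ : E => (1 : ℝ)) x - iteratedFDeriv ℝ i ρ x :=
      iteratedFDeriv_sub_apply contDiff_const.contDiffAt
        (hρ.of_le (mod_cast le_top)).contDiffAt
    rw [this]
    refine (norm_sub_le _ _).trans (add_le_add ?_ (hC x))
    rcases Nat.eq_zero_or_pos i with rfl | hi
    · simp
    · rw [iteratedFDeriv_const_of_ne (by omega)]; simp
  choose C hC0 hC using hbd
  refine ⟨∑ i ∈ Finset.range (m + 1), (m.choose i : ℝ) * C i *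
    SchwartzMap.seminorm ℝ (k + 1) (m - i) χ, fun ε hε hε1 f hf => ?_⟩
  have hnn : 0 ≤ ∑ i ∈ Finset.range (m + 1), (m.choose i : ℝ) * C i *
    SchwartzMap.seminorm ℝ (k + 1) (m - i) χ := Finset.sum_nonneg fun i _ =>
      mul_nonneg (mul_nonneg (by positivity) (hC0 i)) (by positivity)
  refine SchwartzMap.seminorm_le_bound ℝ k m _ (by positivity) fun x => ?_
  have hfun : ((χ - f : 𝓢(E, F)) : E → F) = fun x => (1 - ρ (ε • x)) • χ x := by
    ext x; simp [hf, sub_smul]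
  rw [hfun]
  -- Where `ε‖x‖ < 1` the difference vanishes near `x`. Elsewhere `1 ≤ ε‖x‖` supplies the factor `ε`
  -- at the price of one more power of `‖x‖`, hence the seminorms of weight `k + 1` in the constant.
  by_cases hx : ε * ‖x‖ < 1
  · have hz : (fun x => (1 - ρ (ε • x)) • χ x) =ᶠ[𝓝 x] fun _ => (0 : F) := by
      have : ∀ᶠ y in 𝓝 x, ε * ‖y‖ < 1 :=
        (continuous_const.mul continuous_norm).continuousAt.eventually_lt continuousAt_const hx
      filter_upwards [this] with y hy
      rw [h1 (ε • y) (by rwa [norm_smul, Real.norm_of_nonneg hε.le])]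
      simp
    rw [(hz.iteratedFDeriv ℝ m).eq_of_nhds]
    rw [show (fun _ : E => (0 : F)) = 0 from rfl, iteratedFDeriv_zero]
    simp only [Pi.zero_apply, norm_zero, mul_zero]
    positivity
  · push Not at hx
    have hsc : ContDiff ℝ (⊤ : ℕ∞) (fun x => 1 - ρ (ε • x)) :=
      contDiff_const.sub (hρ.comp (contDiff_const_smul ε))
    have h2 := norm_iteratedFDeriv_smul_le hsc χ.smooth' x (n := m) (mod_cast le_top)
    refine (mul_le_mul_of_nonneg_left h2 (by positivity)).trans ?_
    rw [Finset.mul_sum, Finset.sum_mul]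
    refine Finset.sum_le_sum fun i _ => ?_
    have h3 : ‖iteratedFDeriv ℝ i (fun x => 1 - ρ (ε • x)) x‖ ≤ C i := by
      rw [show (fun x => 1 - ρ (ε • x)) = fun x => (fun y => 1 - ρ y) (ε • x) from rfl,
        iteratedFDeriv_comp_const_smul ε (hσ.of_le (mod_cast le_top))]
      simp only [norm_smul, norm_pow, Real.norm_of_nonneg hε.le]
      exact (mul_le_of_le_one_left (norm_nonneg _) (pow_le_one₀ hε.le hε1)).trans (hC i _)
    have h4 := SchwartzMap.le_seminorm ℝ (k + 1) (m - i) χ x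
    calc ‖x‖ ^ k * ((m.choose i : ℝ) * ‖iteratedFDeriv ℝ i (fun x => 1 - ρ (ε • x)) x‖ *
          ‖iteratedFDeriv ℝ (m - i) χ x‖)
        ≤ (ε * ‖x‖) * (‖x‖ ^ k * ((m.choose i : ℝ) * C i * ‖iteratedFDeriv ℝ (m - i) χ x‖)) := by
          refine le_trans ?_ (le_mul_of_one_le_left ?_ hx)
          · gcongr
          · have := hC0 i; positivity
      _ = (m.choose i : ℝ) * C i * (‖x‖ ^ (k + 1) * ‖iteratedFDeriv ℝ (m - i) χ x‖) * ε := by ring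
      _ ≤ _ := by
          have := hC0 i
          gcongr

/-- Every Schwartz function is a limit of compactly supported Schwartz functions. -/
theorem SchwartzMap.exists_tendsto_hasCompactSupport [FiniteDimensional ℝ E] (χ : 𝓢(E, F)) :
    ∃ f : ℕ → 𝓢(E, F), (∀ n, HasCompactSupport (f n)) ∧ Tendsto f atTop (𝓝 χ) := by
  let ρ : ContDiffBump (0 : E) := ⟨1, 2, one_pos, one_lt_two⟩
  let e : ℕ → ℝ := fun n => 1 / ((n : ℝ) + 1)
  have he0 : ∀ n, 0 < e n := fun n => by positivity
  have hsm : ∀ n, ContDiff ℝ (⊤ : ℕ∞) (fun x => ρ (e n • x) • χ x) := fun n =>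
    (ρ.contDiff.comp (contDiff_const_smul (e n))).smul χ.smooth'
  have hcs : ∀ n, HasCompactSupport (fun x => ρ (e n • x) • χ x) := fun n =>
    ((ρ.hasCompactSupport.comp_smul (he0 n).ne') :
      HasCompactSupport (fun x => ρ (e n • x))).smul_right
  refine ⟨fun n => (hcs n).toSchwartzMap (hsm n), fun n => hcs n, ?_⟩
  rw [(schwartz_withSeminorms ℝ E F).tendsto_nhds]
  rintro ⟨k, m⟩ δ hδ
  obtain ⟨C, hC⟩ := χ.exists_seminorm_sub_cutoff_le ρ ρ.contDiff ρ.hasCompactSupport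
    (fun x hx => ρ.one_of_mem_closedBall (by simpa using hx.le)) k m
  have ht : Tendsto (fun n => C * e n) atTop (𝓝 0) := by
    simpa [e] using (tendsto_one_div_add_atTop_nhds_zero_nat (𝕜 := ℝ)).const_mul C
  filter_upwards [ht.eventually_lt_const hδ] with n hn
  rw [SchwartzMap.schwartzSeminormFamily_apply, map_sub_rev]
  exact (hC (e n) (he0 n) (by rw [div_le_one (by positivity)]; simp) _ (fun x => rfl)).trans_lt hn

end

noncomputable section

namespace BesselHeat

variable {d : ℕ}

/-! ### The symbol of `1 - Δ` -/

/-- The symbol of `1 - Δ`. -/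
def symb (ξ : Rd d) : ℝ := 1 + (2 * Real.pi) ^ 2 * ‖ξ‖ ^ 2

theorem one_le_symb (ξ : Rd d) : 1 ≤ symb ξ := by
  have : 0 ≤ (2 * Real.pi) ^ 2 * ‖ξ‖ ^ 2 := by positivity
  unfold symb; linarith

theorem symb_pos (ξ : Rd d) : 0 < symb ξ := one_pos.trans_le (one_le_symb ξ)

theorem continuous_symb : Continuous (symb : Rd d → ℝ) := by
  unfold symb; fun_prop

theorem continuous_symb_rpow (s : ℝ) : Continuous fun ξ : Rd d => symb ξ ^ s :=
  continuous_symb.rpow_const fun ξ => Or.inl (symb_pos ξ).ne'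

theorem hasTemperateGrowth_symb_rpow (s : ℝ) :
    (fun ξ : Rd d => symb ξ ^ s).HasTemperateGrowth := by
  have h1 := Function.hasTemperateGrowth_one_add_norm_sq_rpow (Rd d) s
  have h2 : (fun ξ : Rd d => (2 * Real.pi) • ξ).HasTemperateGrowth :=
    ((2 * Real.pi) • ContinuousLinearMap.id ℝ (Rd d)).hasTemperateGrowth
  have h3 := h1.comp h2
  refine (congrArg Function.HasTemperateGrowth (funext fun ξ => ?_)).mp h3
  simp only [Function.comp_apply, norm_smul, symb]
  rw [Real.norm_of_nonneg (by positivity), mul_pow]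

theorem hasTemperateGrowth_symb_rpow_ofReal (s : ℝ) :
    (fun ξ : Rd d => ((symb ξ ^ s : ℝ) : ℂ)).HasTemperateGrowth :=
  Function.Complex.hasTemperateGrowth_ofReal.comp (hasTemperateGrowth_symb_rpow s)

/-- The weighted `L²` norm of a function on the Fourier side, squared. -/
def weightedSq (γ : ℝ) (g : Rd d → ℂ) : ℝ≥0∞ :=
  ∫⁻ ξ, ‖g ξ‖ₑ ^ 2 * ENNReal.ofReal (symb ξ ^ γ)

theorem enorm_symb_rpow_mul_sq (γ : ℝ) (ξ : Rd d) (z : ℂ) :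
    ‖((symb ξ ^ (γ / 2) : ℝ) : ℂ) * z‖ₑ ^ 2 = ‖z‖ₑ ^ 2 * ENNReal.ofReal (symb ξ ^ γ) := by
  rw [enorm_mul, mul_pow, mul_comm]
  congr 1
  rw [← ofReal_norm, Complex.norm_real, Real.norm_of_nonneg (by
    have := symb_pos ξ; positivity), ← ENNReal.ofReal_pow (by have := symb_pos ξ; positivity),
    ← Real.rpow_natCast, ← Real.rpow_mul (symb_pos ξ).le]
  congr 2; push_cast; ring

theorem sq_eLpNorm_two {X : Type*} [MeasurableSpace X] {E : Type*} [NormedAddCommGroup E]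
    (μ : Measure X) (f : X → E) : eLpNorm f 2 μ ^ 2 = ∫⁻ x, ‖f x‖ₑ ^ 2 ∂μ := by
  have := eLpNorm_nnreal_pow_eq_lintegral (f := f) (μ := μ) (p := 2) (by norm_num)
  simpa using this

theorem memLp_two_iff {X : Type*} [MeasurableSpace X] {E : Type*} [NormedAddCommGroup E]
    {μ : Measure X} {f : X → E} (hf : AEStronglyMeasurable f μ) :
    MemLp f 2 μ ↔ ∫⁻ x, ‖f x‖ₑ ^ 2 ∂μ < ∞ := by
  rw [← sq_eLpNorm_two]
  simp [MemLp, hf]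

theorem memLp_symb_rpow_mul {γ : ℝ} {g : Rd d → ℂ} (hg : AEStronglyMeasurable g)
    (h : weightedSq γ g < ∞) : MemLp (fun ξ => ((symb ξ ^ (γ / 2) : ℝ) : ℂ) * g ξ) 2 := by
  rw [memLp_two_iff]
  · simpa only [enorm_symb_rpow_mul_sq, weightedSq] using h
  · exact (Complex.continuous_ofReal.comp
      (continuous_symb_rpow (γ / 2))).aestronglyMeasurable.mul hg

theorem symb_rpow_neg_mul_cancel (s : ℝ) (ξ : Rd d) :
    ((symb ξ ^ (-s) : ℝ) : ℂ) * ((symb ξ ^ s : ℝ) : ℂ) = 1 := by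
  rw [← Complex.ofReal_mul, ← Real.rpow_add (symb_pos ξ)]; simp

/-- A function with finite weighted `L²` norm is the density of a tempered distribution. -/
theorem exists_isDensity {γ : ℝ} {g : Rd d → ℂ} (hg : AEStronglyMeasurable g)
    (h : weightedSq γ g < ∞) : ∃ S : TD d, IsDensity S g := by
  have hm := memLp_symb_rpow_mul hg h
  have htg := hasTemperateGrowth_symb_rpow_ofReal (d := d) (-(γ / 2))
  -- The function `g` need not be in `L²`, but `symb ^ (γ/2) * g` is. The missing factor `symb ^
  -- (-γ/2)` has temperate growth and can be moved onto the test function.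
  refine ⟨TemperedDistribution.smulLeftCLM ℂ (fun ξ => ((symb ξ ^ (-(γ / 2)) : ℝ) : ℂ))
    (Lp.toTemperedDistribution (hm.toLp _)), fun ψ => ?_⟩
  have he : ∀ ξ, SchwartzMap.smulLeftCLM ℂ (fun ξ => ((symb ξ ^ (-(γ / 2)) : ℝ) : ℂ)) ψ ξ *
      (((symb ξ ^ (γ / 2) : ℝ) : ℂ) * g ξ) = ψ ξ * g ξ := fun ξ => by
    rw [SchwartzMap.smulLeftCLM_apply_apply htg, smul_eq_mul]
    calc _ = (((symb ξ ^ (-(γ / 2)) : ℝ) : ℂ) * ((symb ξ ^ (γ / 2) : ℝ) : ℂ)) * (ψ ξ * g ξ) := by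
          ring
      _ = _ := by rw [symb_rpow_neg_mul_cancel, one_mul]
  constructor
  · refine Integrable.congr (MemLp.integrable_mul (SchwartzMap.memLp (SchwartzMap.smulLeftCLM ℂ
      (fun ξ => ((symb ξ ^ (-(γ / 2)) : ℝ) : ℂ)) ψ) 2) hm) (ae_of_all _ fun ξ => ?_)
    exact he ξ
  · rw [TemperedDistribution.smulLeftCLM_apply_apply, Lp.toTemperedDistribution_apply]
    refine integral_congr_ae ?_
    filter_upwards [hm.coeFn_toLp] with ξ hξ
    rw [hξ, smul_eq_mul, he]

/-! ### Densities -/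

theorem IsDensity.unique {S S' : TD d} {f : Rd d → ℂ} (h : IsDensity S f) (h' : IsDensity S' f) :
    S = S' := by
  ext ψ
  rw [(h ψ).2, (h' ψ).2]

theorem IsDensity.funDist_eq {S : TD d} {f : Rd d → ℂ} (h : IsDensity S f) : funDist f = S := by
  have hex : ∃ S : TD d, IsDensity S f := ⟨S, h⟩
  rw [funDist, dif_pos hex]
  exact hex.choose_spec.unique h

theorem IsDensity.congr {S : TD d} {f g : Rd d → ℂ} (h : IsDensity S f) (hfg : f =ᵐ[volume] g) :
    IsDensity S g := fun ψ => by
  have : (fun x => ψ x * f x) =ᵐ[volume] fun x => ψ x * g x := by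
    filter_upwards [hfg] with x hx; rw [hx]
  exact ⟨(h ψ).1.congr this, by rw [(h ψ).2]; exact integral_congr_ae this⟩

/-- Testing with a smooth bump equal to one on a ball gives integrability on that ball. -/
theorem IsDensity.locallyIntegrable {S : TD d} {f : Rd d → ℂ} (h : IsDensity S f) :
    LocallyIntegrable f := by
  intro x
  let ρ : ContDiffBump x := ⟨1, 2, one_pos, one_lt_two⟩
  have hs : ContDiff ℝ (⊤ : ℕ∞) (fun y => ((ρ y : ℝ) : ℂ)) :=
    Complex.ofRealCLM.contDiff.comp ρ.contDiff
  have hc : HasCompactSupport (fun y => ((ρ y : ℝ) : ℂ)) :=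
    ρ.hasCompactSupport.comp_left (g := fun r : ℝ => (r : ℂ)) rfl
  refine ⟨Metric.closedBall x 1, Metric.closedBall_mem_nhds _ one_pos, ?_⟩
  refine ((h (hc.toSchwartzMap hs)).1.integrableOn).congr_fun (fun y hy => ?_)
    Metric.isClosed_closedBall.measurableSet
  simp [ρ.one_of_mem_closedBall hy]

theorem IsDensity.isFourierDensity {S : TD d} {g : Rd d → ℂ} (h : IsDensity (𝓕 S) g) :
    IsFourierDensity S g :=
  ⟨h.locallyIntegrable, fun ψ _ => (h ψ).2⟩

theorem IsFourierDensity.ae_eq {S : TD d} {g g' : Rd d → ℂ} (h : IsFourierDensity S g)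
    (h' : IsFourierDensity S g') : g =ᵐ[volume] g' := by
  refine ae_eq_of_integral_contDiff_smul_eq h.1 h'.1 fun ρ hρ hc => ?_
  have hs : ContDiff ℝ (⊤ : ℕ∞) (fun y => ((ρ y : ℝ) : ℂ)) :=
    Complex.ofRealCLM.contDiff.comp hρ
  have hc' : HasCompactSupport (fun y => ((ρ y : ℝ) : ℂ)) :=
    hc.comp_left (g := fun r : ℝ => (r : ℂ)) rfl
  have := (h.2 (hc'.toSchwartzMap hs) hc').symm.trans (h'.2 (hc'.toSchwartzMap hs) hc')
  simpa [Complex.real_smul] using this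

theorem IsFourierDensity.congr {S : TD d} {g g' : Rd d → ℂ} (h : IsFourierDensity S g)
    (hg : g =ᵐ[volume] g') : IsFourierDensity S g' := by
  refine ⟨(locallyIntegrable_congr hg).mp h.1, fun ψ hψ => ?_⟩
  rw [h.2 ψ hψ]
  refine integral_congr_ae ?_
  filter_upwards [hg] with x hx; rw [hx]

theorem IsFourierDensity.integrable_mul {S : TD d} {g : Rd d → ℂ} (h : IsFourierDensity S g)
    (ψ : 𝓢(Rd d, ℂ)) (hψ : HasCompactSupport ψ) : Integrable (fun ξ => ψ ξ * g ξ) := by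
  simpa using h.1.integrable_smul_left_of_hasCompactSupport ψ.continuous hψ

theorem IsFourierDensity.sub {S S' : TD d} {g g' : Rd d → ℂ} (h : IsFourierDensity S g)
    (h' : IsFourierDensity S' g') : IsFourierDensity (S - S') (fun ξ => g ξ - g' ξ) := by
  refine ⟨h.1.sub h'.1, fun ψ hψ => ?_⟩
  have e1 : (𝓕 (S - S')) ψ = 𝓕 S ψ - 𝓕 S' ψ := rfl
  rw [e1, h.2 ψ hψ, h'.2 ψ hψ, ← integral_sub (h.integrable_mul ψ hψ) (h'.integrable_mul ψ hψ)]
  simp only [mul_sub]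

theorem IsFourierDensity.add {S S' : TD d} {g g' : Rd d → ℂ} (h : IsFourierDensity S g)
    (h' : IsFourierDensity S' g') : IsFourierDensity (S + S') (fun ξ => g ξ + g' ξ) := by
  refine ⟨h.1.add h'.1, fun ψ hψ => ?_⟩
  have e1 : (𝓕 (S + S')) ψ = 𝓕 S ψ + 𝓕 S' ψ := rfl
  rw [e1, h.2 ψ hψ, h'.2 ψ hψ, ← integral_add (h.integrable_mul ψ hψ) (h'.integrable_mul ψ hψ)]
  simp only [mul_add]

/-- Tempered distributions are determined by their values on compactly supported functions. -/
theorem ext_of_hasCompactSupport {S S' : TD d}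
    (h : ∀ ψ : 𝓢(Rd d, ℂ), HasCompactSupport ψ → S ψ = S' ψ) : S = S' := by
  ext χ
  obtain ⟨f, hf, hlim⟩ := χ.exists_tendsto_hasCompactSupport
  have h1 := (S.continuous.tendsto χ).comp hlim
  have h2 := (S'.continuous.tendsto χ).comp hlim
  refine tendsto_nhds_unique h1 (h2.congr fun n => ?_)
  exact (h _ (hf n)).symm

/-- A finite weighted norm makes `g` the density of some tempered distribution. It agrees with `𝓕 S`
on compactly supported functions, and these are dense. This removes the support restriction on test
functions, which is needed because `𝓕⁻ ψ` is not compactly supported in general. -/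
theorem IsFourierDensity.isDensity {S : TD d} {g : Rd d → ℂ} (h : IsFourierDensity S g) {γ : ℝ}
    (hg : weightedSq γ g < ∞) : IsDensity (𝓕 S) g := by
  obtain ⟨S', hS'⟩ := exists_isDensity h.1.aestronglyMeasurable hg
  have : 𝓕 S = S' := ext_of_hasCompactSupport fun ψ hψ => by rw [h.2 ψ hψ, (hS' ψ).2]
  rwa [this]

theorem sobolevSq_eq {γ : ℝ} {S : TD d} {g : Rd d → ℂ} (h : IsFourierDensity S g) :
    sobolevSq γ S = weightedSq γ g := by
  refine le_antisymm (iInf₂_le g h) (le_iInf₂ fun g' h' => le_of_eq ?_)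
  refine lintegral_congr_ae ?_
  filter_upwards [h.ae_eq h'] with ξ hξ
  rw [hξ]; rfl

theorem isFourierDensity_zero : IsFourierDensity (0 : TD d) 0 := by
  refine ⟨(integrable_zero _ _ _).locallyIntegrable, fun ψ _ => ?_⟩
  simp

/-! ### Integrable functions and their Fourier transforms -/

theorem continuous_fourier_of_integrable {f : Rd d → ℂ} (hf : Integrable f) :
    Continuous (𝓕 f) :=
  VectorFourier.fourierIntegral_continuous Real.continuous_fourierChar
    (innerSL ℝ).continuous₂ hf

theorem norm_fourier_le_integral (f : Rd d → ℂ) (ξ : Rd d) : ‖𝓕 f ξ‖ ≤ ∫ x, ‖f x‖ :=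
  VectorFourier.norm_fourierIntegral_le_integral_norm _ _ _ _ _

theorem integral_fourier_mul_eq {f g : Rd d → ℂ} (hf : Integrable f) (hg : Integrable g) :
    ∫ ξ, 𝓕 f ξ * g ξ = ∫ x, f x * 𝓕 g x := by
  have := VectorFourier.integral_bilin_fourierIntegral_eq_flip (ContinuousLinearMap.mul ℂ ℂ)
    (L := innerₗ (Rd d)) (μ := volume) (ν := volume) Real.continuous_fourierChar
    continuous_inner hf hg
  simpa using! this

theorem integral_fourierInv_mul_eq {f g : Rd d → ℂ} (hf : Integrable f) (hg : Integrable g) :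
    ∫ ξ, 𝓕⁻ f ξ * g ξ = ∫ x, f x * 𝓕⁻ g x := by
  have h := integral_fourier_mul_eq hf hg.comp_neg
  simp only [Real.fourierInv_eq_fourier_neg]
  rw [← integral_neg_eq_self]
  simp only [neg_neg]
  rw [h]
  congr 1 with x
  congr 1
  exact (congrFun (Real.fourierInv_eq_fourier_comp_neg g) x).symm.trans
    (Real.fourierInv_eq_fourier_neg g x)

theorem integrable_schwartz_mul (ψ : 𝓢(Rd d, ℂ)) {f : Rd d → ℂ} (hf : Integrable f) :
    Integrable (fun x => ψ x * f x) := by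
  obtain ⟨C, hC⟩ := ψ.decay 0 0
  exact hf.bdd_mul (c := C) ψ.continuous.aestronglyMeasurable
    (ae_of_all _ fun x => by simpa using hC.2 x)

theorem exists_isDensity_of_integrable {f : Rd d → ℂ} (hf : Integrable f) :
    ∃ S : TD d, IsDensity S f := by
  refine ⟨Lp.toTemperedDistribution ((memLp_one_iff_integrable.mpr hf).toLp f), fun ψ =>
    ⟨integrable_schwartz_mul ψ hf, ?_⟩⟩
  rw [Lp.toTemperedDistribution_apply]
  refine integral_congr_ae ?_
  filter_upwards [(memLp_one_iff_integrable.mpr hf).coeFn_toLp] with ξ hξ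
  rw [hξ, smul_eq_mul]

theorem IsDensity.fourier {S : TD d} {f : Rd d → ℂ} (h : IsDensity S f) (hf : Integrable f) :
    IsDensity (𝓕 S) (𝓕 f) := fun ψ => by
  refine ⟨?_, ?_⟩
  · rw [← memLp_one_iff_integrable]
    exact memLp_one_iff_integrable.mpr <| (ψ.integrable (μ := volume)).mul_bdd
      (c := ∫ x, ‖f x‖)
      (continuous_fourier_of_integrable hf).aestronglyMeasurable
      (ae_of_all _ fun ξ => norm_fourier_le_integral f ξ)
  · rw [TemperedDistribution.fourier_apply, (h _).2, ← integral_fourier_mul_eq ψ.integrable hf]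
    rfl

/-- The tempered distribution whose Fourier transform is a given integrable function. -/
theorem exists_fourier_isDensity_of_integrable {H : Rd d → ℂ} (hH : Integrable H) :
    ∃ S : TD d, IsDensity (𝓕 S) H ∧ IsDensity S (𝓕⁻ H) := by
  obtain ⟨S, hS⟩ := exists_isDensity_of_integrable hH
  refine ⟨𝓕⁻ S, by rwa [FourierTransform.fourier_fourierInv_eq], fun ψ => ⟨?_, ?_⟩⟩
  · refine (ψ.integrable (μ := volume)).mul_bdd (c := ∫ x, ‖H x‖) ?_
      (ae_of_all _ fun ξ => ?_)
    · rw [Real.fourierInv_eq_fourier_comp_neg]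
      exact (continuous_fourier_of_integrable hH.comp_neg).aestronglyMeasurable
    · rw [Real.fourierInv_eq_fourier_neg]
      exact norm_fourier_le_integral H _
  · rw [TemperedDistribution.fourierInv_apply, (hS _).2, ← integral_fourierInv_mul_eq
      ψ.integrable hH, SchwartzMap.fourierInv_coe]

theorem isFourierDensity_funDist {f : Rd d → ℂ} (hf : Integrable f) :
    IsFourierDensity (funDist f) (𝓕 f) := by
  obtain ⟨S, hS⟩ := exists_isDensity_of_integrable hf
  rw [hS.funDist_eq]
  exact (hS.fourier hf).isFourierDensity

/-- Plancherel's theorem for integrable functions. -/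
theorem lintegral_enorm_fourier_sq {f : Rd d → ℂ} (hf : Integrable f) (hf2 : MemLp f 2) :
    ∫⁻ ξ, ‖𝓕 f ξ‖ₑ ^ 2 = ∫⁻ x, ‖f x‖ₑ ^ 2 := by
  -- The Fourier integral and the `L²` Fourier transform of `f` are both Fourier densities of one
  -- distribution, hence equal almost everywhere. The isometry of the latter then carries over.
  have h1 : IsDensity (Lp.toTemperedDistribution (hf2.toLp f)) f := fun ψ => by
    refine ⟨integrable_schwartz_mul ψ hf, ?_⟩
    rw [Lp.toTemperedDistribution_apply]
    refine integral_congr_ae ?_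
    filter_upwards [hf2.coeFn_toLp] with ξ hξ
    rw [hξ, smul_eq_mul]
  have h2 : IsFourierDensity (Lp.toTemperedDistribution (hf2.toLp f)) (𝓕 (hf2.toLp f) : Lp ℂ 2 _) := by
    refine ⟨(Lp.memLp _).locallyIntegrable one_le_two, fun ψ _ => ?_⟩
    rw [Lp.fourier_toTemperedDistribution_eq, Lp.toTemperedDistribution_apply]
    rfl
  have h3 := (h1.fourier hf).isFourierDensity.ae_eq h2
  have h4 : eLpNorm (𝓕 f) 2 volume = eLpNorm f 2 volume := by
    rw [eLpNorm_congr_ae h3, ← Lp.enorm_def, ← eLpNorm_congr_ae hf2.coeFn_toLp, ← Lp.enorm_def,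
      ← ofReal_norm, Lp.norm_fourier_eq, ofReal_norm]
  rw [← sq_eLpNorm_two, ← sq_eLpNorm_two, h4]

theorem measurable_fourier_prod {X : Type*} [MeasurableSpace X] {f : X → Rd d → ℂ}
    (hf : Measurable fun p : X × Rd d => f p.1 p.2) :
    Measurable fun p : X × Rd d => 𝓕 (f p.1) p.2 := by
  have h1 : StronglyMeasurable fun q : (X × Rd d) × Rd d =>
      ((Real.fourierChar (-(inner ℝ q.2 q.1.2)) : Circle) : ℂ) * f q.1.1 q.2 := by
    refine Measurable.stronglyMeasurable (Measurable.mul ?_ ?_)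
    · have hc : Continuous fun r : ℝ => ((Real.fourierChar (-r) : Circle) : ℂ) :=
        continuous_subtype_val.comp (Real.continuous_fourierChar.comp continuous_neg)
      exact hc.measurable.comp ((measurable_snd).inner (measurable_snd.comp measurable_fst))
    · exact hf.comp ((measurable_fst.comp measurable_fst).prodMk measurable_snd)
  have h2 := h1.integral_prod_right' (ν := (volume : Measure (Rd d)))
  simp only [Real.fourier_eq]
  exact h2.measurable

end BesselHeat

end

/-! ### Density of test functions in `L²` of an open set -/

section
variable {E : Type*} [NormedAddCommGroup E] [NormedSpace ℝ E]
  [MeasurableSpace E] [BorelSpace E] {μ : Measure E} [IsFiniteMeasureOnCompacts μ]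

theorem TestFunction.memLp_restrict {Ω : TopologicalSpace.Opens E} (η : 𝓓(Ω, ℝ)) :
    MemLp η 2 (μ.restrict Ω) :=
  (η.continuous.memLp_of_hasCompactSupport η.hasCompactSupport).restrict _

/-- Test functions are dense in `L²` of an open set. -/
theorem TestFunction.exists_eLpNorm_sub_lt [FiniteDimensional ℝ E] {Ω : TopologicalSpace.Opens E} {f : E → ℝ}
    (hf : MemLp f 2 (μ.restrict Ω)) {ε : ℝ≥0∞} (hε : 0 < ε) :
    ∃ η : 𝓓(Ω, ℝ), eLpNorm (⇑η - f) 2 (μ.restrict Ω) < ε := by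
  let L : 𝓓(Ω, ℝ) →ₗ[ℝ] Lp ℝ 2 (μ.restrict Ω) :=
    { toFun := fun η => (TestFunction.memLp_restrict η).toLp η
      map_add' := fun η η' => rfl
      map_smul' := fun c η => rfl }
  -- A function orthogonal to all test functions vanishes by the fundamental lemma of the calculus
  -- of variations, so the orthogonal complement of the range is trivial.
  have hdense : L.range.topologicalClosure = ⊤ := by
    rw [Submodule.topologicalClosure_eq_top_iff, Submodule.eq_bot_iff]
    intro g hg
    have hli : LocallyIntegrableOn g (Ω : Set E) μ :=
      locallyIntegrableOn_of_locallyIntegrable_restrict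
        ((Lp.memLp g).locallyIntegrable one_le_two)
    have hz := Ω.isOpen.ae_eq_zero_of_integral_contDiff_smul_eq_zero hli (fun η hη hc hs => by
      have h1 := (Submodule.mem_orthogonal L.range g).mp hg (L ⟨η, hη, hc, hs⟩) ⟨_, rfl⟩
      rw [L2.inner_def] at h1
      rw [← setIntegral_eq_integral_of_forall_compl_eq_zero (s := (Ω : Set E)) (fun x hx => by
        rw [image_eq_zero_of_notMem_tsupport (fun hh => hx (hs hh)), zero_smul]), ← h1]
      refine integral_congr_ae ?_
      filter_upwards [(TestFunction.memLp_restrict (μ := μ)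
        (⟨η, hη, hc, hs⟩ : 𝓓(Ω, ℝ))).coeFn_toLp] with x hx
      change _ = inner ℝ ((TestFunction.memLp_restrict (μ := μ)
        (⟨η, hη, hc, hs⟩ : 𝓓(Ω, ℝ))).toLp _ x) (g x)
      rw [hx]
      simp [mul_comm])
    rw [Lp.eq_zero_iff_ae_eq_zero]
    exact (ae_restrict_iff' Ω.isOpen.measurableSet).mpr hz
  have hmem : hf.toLp f ∈ closure (L.range : Set (Lp ℝ 2 (μ.restrict Ω))) := by
    have : hf.toLp f ∈ L.range.topologicalClosure := by rw [hdense]; trivial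
    exact this
  obtain ⟨_, ⟨η, rfl⟩, hη⟩ := EMetric.mem_closure_iff.mp hmem ε hε
  refine ⟨η, ?_⟩
  rw [edist_comm] at hη
  change edist ((TestFunction.memLp_restrict η).toLp η) (hf.toLp f) < ε at hη
  rwa [Lp.edist_toLp_toLp] at hη

end

noncomputable section

namespace BesselHeat

variable {d : ℕ}

/-! ### Jointly measurable Fourier densities of distribution-valued functions -/

/-- Lebesgue measure on `[0,T] × ℝ^d`. -/
abbrev slab (d : ℕ) (T : ℝ) : Measure (ℝ × Rd d) :=
  (volume.restrict (Icc 0 T)).prod volume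

/-- `k` is a jointly measurable version of the Fourier transforms of the `φ t`. -/
structure FourierRep (T : ℝ) (φ : ℝ → TD d) (k : ℝ → Rd d → ℂ) : Prop where
  aemeasurable : AEMeasurable (fun p : ℝ × Rd d => k p.1 p.2) (slab d T)
  density : ∀ᵐ t ∂(volume.restrict (Icc 0 T)), IsFourierDensity (φ t) (k t)

/-- Multiplication by the square root of the weight. -/
def wtd (γ : ℝ) (k : ℝ → Rd d → ℂ) (p : ℝ × Rd d) : ℂ := ((symb p.2 ^ (γ / 2) : ℝ) : ℂ) * k p.1 p.2

theorem continuous_symb_rpow_ofReal (s : ℝ) :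
    Continuous fun ξ : Rd d => ((symb ξ ^ s : ℝ) : ℂ) :=
  Complex.continuous_ofReal.comp (continuous_symb_rpow s)

theorem aemeasurable_wtd {γ : ℝ} {k : ℝ → Rd d → ℂ} {μ : Measure (ℝ × Rd d)}
    (hk : AEMeasurable (fun p : ℝ × Rd d => k p.1 p.2) μ) : AEMeasurable (wtd γ k) μ :=
  ((continuous_symb_rpow_ofReal (γ / 2)).measurable.comp measurable_snd).aemeasurable.mul hk

/-- Tonelli. Half the weight is put into `wtd`, so that Sobolev norms in time and space become plain
`L²` norms and the Hilbert space theory of `Lp` applies. -/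
theorem sq_eLpNorm_wtd {γ : ℝ} {k : ℝ → Rd d → ℂ} {μ : Measure ℝ} [SFinite μ]
    (hk : AEMeasurable (fun p : ℝ × Rd d => k p.1 p.2) (μ.prod volume)) :
    eLpNorm (wtd γ k) 2 (μ.prod volume) ^ 2 = ∫⁻ t, weightedSq γ (k t) ∂μ := by
  rw [sq_eLpNorm_two, lintegral_prod]
  · simp only [wtd, enorm_symb_rpow_mul_sq, weightedSq]
  · exact ((aemeasurable_wtd hk).enorm).pow_const 2

theorem FourierRep.lintegral_sobolevSq {T : ℝ} {φ : ℝ → TD d} {k : ℝ → Rd d → ℂ}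
    (h : FourierRep T φ k) (γ : ℝ) :
    ∫⁻ t in Icc 0 T, sobolevSq γ (φ t) = eLpNorm (wtd γ k) 2 (slab d T) ^ 2 := by
  rw [sq_eLpNorm_wtd h.aemeasurable]
  refine lintegral_congr_ae ?_
  filter_upwards [h.density] with t ht
  exact sobolevSq_eq ht

theorem FourierRep.sub {T : ℝ} {φ ψ : ℝ → TD d} {k l : ℝ → Rd d → ℂ}
    (h : FourierRep T φ k) (h' : FourierRep T ψ l) :
    FourierRep T (fun t => φ t - ψ t) (fun t ξ => k t ξ - l t ξ) where
  aemeasurable := h.aemeasurable.sub h'.aemeasurable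
  density := by
    filter_upwards [h.density, h'.density] with t ht ht'
    exact ht.sub ht'

theorem wtd_sub (γ : ℝ) (k l : ℝ → Rd d → ℂ) :
    wtd γ (fun t ξ => k t ξ - l t ξ) = wtd γ k - wtd γ l := by
  ext p; simp [wtd, mul_sub]

theorem FourierRep.normZeroSq_eq {α T : ℝ} {φ : ℝ → TD d} {k : ℝ → Rd d → ℂ}
    (h : FourierRep T φ k) :
    normZeroSq α T φ = eLpNorm (wtd (-α / 2) k) 2 (slab d T) ^ 2 :=
  h.lintegral_sobolevSq _

theorem FourierRep.normZeroSq_sub_eq {α T : ℝ} {φ ψ : ℝ → TD d} {k l : ℝ → Rd d → ℂ}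
    (h : FourierRep T φ k) (h' : FourierRep T ψ l) :
    normZeroSq α T (fun t => φ t - ψ t) =
      eLpNorm (wtd (-α / 2) k - wtd (-α / 2) l) 2 (slab d T) ^ 2 := by
  rw [(h.sub h').normZeroSq_eq, wtd_sub]

/-- The Fourier transforms of the slices of a function. -/
def sliceFourier (ψ : ℝ → Rd d → ℝ) (t : ℝ) : Rd d → ℂ := 𝓕 (fun x => (ψ t x : ℂ))

theorem measurable_sliceFourier {ψ : ℝ → Rd d → ℝ}
    (hψ : Measurable fun p : ℝ × Rd d => ψ p.1 p.2) :
    Measurable fun p : ℝ × Rd d => sliceFourier ψ p.1 p.2 :=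
  measurable_fourier_prod (f := fun t x => (ψ t x : ℂ)) (Complex.measurable_ofReal.comp hψ)

theorem fourierRep_slices {T : ℝ} {ψ : ℝ → Rd d → ℝ}
    (hψ : Measurable fun p : ℝ × Rd d => ψ p.1 p.2) (hi : ∀ t ∈ Icc 0 T, Integrable (ψ t)) :
    FourierRep T (slices ψ) (sliceFourier ψ) where
  aemeasurable := (measurable_sliceFourier hψ).aemeasurable
  density := (ae_restrict_iff' measurableSet_Icc).mpr <| ae_of_all _ fun t ht =>
    isFourierDensity_funDist (hi t ht).ofReal

/-! ### Approximation by test functions -/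

theorem slab_eq_restrict (T : ℝ) : slab d T = volume.restrict (Icc 0 T ×ˢ univ) := by
  rw [Measure.volume_eq_prod, ← Measure.prod_restrict, Measure.restrict_univ]

theorem slab_eq_restrict_strip (T : ℝ) :
    slab d T = volume.restrict (strip d T : Set (ℝ × Rd d)) := by
  change _ = volume.restrict (Ioo 0 T ×ˢ univ)
  rw [Measure.volume_eq_prod, ← Measure.prod_restrict, Measure.restrict_univ,
    Measure.restrict_congr_set Ioo_ae_eq_Icc]

theorem ae_slab_mem (T : ℝ) : ∀ᵐ p ∂(slab d T), p.1 ∈ Icc 0 T := by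
  rw [slab_eq_restrict]
  filter_upwards [ae_restrict_mem (measurableSet_Icc.prod MeasurableSet.univ)] with p hp
  exact hp.1

theorem weightedSq_le_lintegral {γ : ℝ} (hγ : γ ≤ 0) (g : Rd d → ℂ) :
    weightedSq γ g ≤ ∫⁻ ξ, ‖g ξ‖ₑ ^ 2 := by
  refine lintegral_mono fun ξ => ?_
  refine mul_le_of_le_one_right' ?_
  rw [ENNReal.ofReal_le_one]
  exact Real.rpow_le_one_of_one_le_of_nonpos (one_le_symb ξ) hγ

theorem sliceFourier_sub {ψ η : ℝ → Rd d → ℝ} {t : ℝ} (h : Integrable (ψ t))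
    (h' : Integrable (η t)) :
    sliceFourier (fun s x => ψ s x - η s x) t = fun ξ => sliceFourier ψ t ξ - sliceFourier η t ξ := by
  ext ξ
  have := congrFun (VectorFourier.fourierIntegral_add (e := Real.fourierChar) (μ := volume)
    (L := innerₗ (Rd d)) Real.continuous_fourierChar continuous_inner
    (f := fun x => ((ψ t x - η t x : ℝ) : ℂ)) (g := fun x => (η t x : ℂ))
    (h.sub h').ofReal h'.ofReal) ξ
  rw [eq_sub_iff_add_eq]
  refine Eq.trans this.symm ?_
  have e : ((fun x => ((ψ t x - η t x : ℝ) : ℂ)) + fun x => (η t x : ℂ)) = fun x => (ψ t x : ℂ) := by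
    ext x; simp
  rw [e]
  rfl

/-- The `L²` norm dominates the norms of negative order. -/
theorem eLpNorm_wtd_sliceFourier_le {γ T : ℝ} (hγ : γ ≤ 0) {ψ : ℝ → Rd d → ℝ}
    (hψ : Measurable fun p : ℝ × Rd d => ψ p.1 p.2) (hi : ∀ t ∈ Icc 0 T, Integrable (ψ t))
    (h2 : ∀ t ∈ Icc 0 T, MemLp (ψ t) 2) :
    eLpNorm (wtd γ (sliceFourier ψ)) 2 (slab d T) ≤
      eLpNorm (fun p : ℝ × Rd d => ψ p.1 p.2) 2 (slab d T) := by
  rw [← ENNReal.pow_le_pow_left_iff two_ne_zero,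
    sq_eLpNorm_wtd (measurable_sliceFourier hψ).aemeasurable, sq_eLpNorm_two,
    lintegral_prod _ (hψ.enorm.pow_const 2).aemeasurable]
  refine setLIntegral_mono' measurableSet_Icc fun t ht => ?_
  refine (weightedSq_le_lintegral hγ _).trans ?_
  rw [sliceFourier, lintegral_enorm_fourier_sq (f := fun x => (ψ t x : ℂ))
    (hi t ht).ofReal (h2 t ht).ofReal]
  refine lintegral_mono fun x => le_of_eq ?_
  rw [← ofReal_norm, Complex.norm_real, ofReal_norm]

theorem hasCompactSupport_slice {T : ℝ} (η : 𝓓(strip d T, ℝ)) (t : ℝ) :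
    HasCompactSupport fun x => η (t, x) :=
  η.hasCompactSupport.comp_isClosedEmbedding
    ⟨isEmbedding_prodMkRight t, by
      have : range (Prod.mk t : Rd d → ℝ × Rd d) = {t} ×ˢ univ := by ext ⟨a, b⟩; simp [eq_comm]
      rw [this]
      exact isClosed_singleton.prod isClosed_univ⟩

theorem continuous_slice {T : ℝ} (η : 𝓓(strip d T, ℝ)) (t : ℝ) :
    Continuous fun x => η (t, x) :=
  η.continuous.comp (by fun_prop)

theorem integrable_slice {T : ℝ} (η : 𝓓(strip d T, ℝ)) (t : ℝ) :
    Integrable fun x => η (t, x) :=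
  (continuous_slice η t).integrable_of_hasCompactSupport (hasCompactSupport_slice η t)

theorem memLp_slice {T : ℝ} (η : 𝓓(strip d T, ℝ)) (t : ℝ) :
    MemLp (fun x => η (t, x)) 2 :=
  (continuous_slice η t).memLp_of_hasCompactSupport (hasCompactSupport_slice η t)

theorem measurable_testFunction {T : ℝ} (η : 𝓓(strip d T, ℝ)) :
    Measurable fun p : ℝ × Rd d => η (p.1, p.2) := η.continuous.measurable

/-- The Fourier transforms of the slices of a test function. -/
def testFourier {T : ℝ} (η : 𝓓(strip d T, ℝ)) : ℝ → Rd d → ℂ := sliceFourier fun s x => η (s, x)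

theorem fourierRep_testFunction {T : ℝ} (η : 𝓓(strip d T, ℝ)) :
    FourierRep T (slices fun s x => η (s, x)) (testFourier η) :=
  fourierRep_slices (measurable_testFunction η) fun t _ => integrable_slice η t

/-- Cutting off the times at which the `L²` norm is large. -/
theorem exists_truncation {γ T : ℝ} {ψ : ℝ → Rd d → ℝ}
    (hψ : Measurable fun p : ℝ × Rd d => ψ p.1 p.2)
    (h2 : ∀ t ∈ Icc 0 T, MemLp (ψ t) 2)
    (hfin : eLpNorm (wtd γ (sliceFourier ψ)) 2 (slab d T) < ∞) {ε : ℝ≥0∞} (hε : 0 < ε) :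
    ∃ A : Set ℝ, MeasurableSet A ∧
      MemLp (fun p : ℝ × Rd d => A.indicator ψ p.1 p.2) 2 (slab d T) ∧
      eLpNorm (wtd γ (sliceFourier (A.indicator ψ)) - wtd γ (sliceFourier ψ)) 2 (slab d T) < ε := by
  -- On `[0,T]` this energy is finite at every time but need not be integrable in time. Its sublevel
  -- sets `A n` exhaust `[0,T]` and bound it by `n`.
  let N : ℝ → ℝ≥0∞ := fun t => ∫⁻ x, ‖ψ t x‖ₑ ^ 2
  have hN : Measurable N := (hψ.enorm.pow_const 2).lintegral_prod_right'
  let A : ℕ → Set ℝ := fun n => {t | N t ≤ n}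
  have hA : ∀ n, MeasurableSet (A n) := fun n => measurableSet_le hN measurable_const
  have hmeas : ∀ n, Measurable fun p : ℝ × Rd d => (A n).indicator ψ p.1 p.2 := fun n => by
    have : (fun p : ℝ × Rd d => (A n).indicator ψ p.1 p.2) =
        (A n ×ˢ univ).indicator fun p => ψ p.1 p.2 := by
      ext p
      by_cases hp : p.1 ∈ A n <;> simp [indicator, hp]
    rw [this]
    exact hψ.indicator ((hA n).prod MeasurableSet.univ)
  have hmem : ∀ n, MemLp (fun p : ℝ × Rd d => (A n).indicator ψ p.1 p.2) 2 (slab d T) := fun n => by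
    rw [memLp_two_iff (hmeas n).aestronglyMeasurable,
      lintegral_prod _ ((hmeas n).enorm.pow_const 2).aemeasurable]
    calc ∫⁻ t in Icc 0 T, ∫⁻ x, ‖(A n).indicator ψ t x‖ₑ ^ 2
        ≤ ∫⁻ t in Icc 0 T, (n : ℝ≥0∞) := by
          refine lintegral_mono fun t => ?_
          by_cases ht : t ∈ A n
          · simpa only [indicator_of_mem ht] using! ht
          · simp [indicator_of_notMem ht]
      _ < ∞ := by
          rw [setLIntegral_const]
          exact ENNReal.mul_lt_top (by simp) (by simp)
  -- Truncation in time commutes with the Fourier transform in space, so dominated convergence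
  -- applies with the untruncated transform as majorant.
  have hpt : ∀ n (p : ℝ × Rd d), wtd γ (sliceFourier ((A n).indicator ψ)) p =
      (A n ×ˢ univ).indicator (wtd γ (sliceFourier ψ)) p := fun n p => by
    by_cases hp : p.1 ∈ A n
    · have hp' : p ∈ A n ×ˢ (univ : Set (Rd d)) := ⟨hp, trivial⟩
      rw [indicator_of_mem hp']
      simp only [wtd, sliceFourier, indicator_of_mem hp]
    · have hp' : p ∉ A n ×ˢ (univ : Set (Rd d)) := fun h => hp h.1
      rw [indicator_of_notMem hp']
      simp only [wtd, sliceFourier, indicator_of_notMem hp]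
      simp [Real.fourier_eq]
  have hw : Measurable (wtd γ (sliceFourier ψ)) :=
    ((continuous_symb_rpow_ofReal (γ / 2)).measurable.comp measurable_snd).mul
      (measurable_sliceFourier hψ)
  have hlim : Tendsto (fun n => ∫⁻ p, ‖(wtd γ (sliceFourier ((A n).indicator ψ)) -
      wtd γ (sliceFourier ψ)) p‖ₑ ^ 2 ∂(slab d T)) atTop (𝓝 (∫⁻ _, 0 ∂(slab d T))) := by
    refine tendsto_lintegral_of_dominated_convergence
      (fun p => ‖wtd γ (sliceFourier ψ) p‖ₑ ^ 2) (fun n => ?_) (fun n => ?_) ?_ ?_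
    · have : wtd γ (sliceFourier ((A n).indicator ψ)) =
        (A n ×ˢ univ).indicator (wtd γ (sliceFourier ψ)) := funext (hpt n)
      rw [this]
      exact (((hw.indicator ((hA n).prod MeasurableSet.univ)).sub hw).enorm).pow_const 2
    · refine ae_of_all _ fun p => ?_
      simp only [Pi.sub_apply, hpt]
      by_cases hp : p ∈ A n ×ˢ (univ : Set (Rd d))
      · simp [indicator_of_mem hp]
      · simp [indicator_of_notMem hp]
    · rw [← sq_eLpNorm_two]
      exact (ENNReal.pow_lt_top hfin).ne
    · filter_upwards [ae_slab_mem T] with p hp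
      have hNp : N p.1 < ∞ := (memLp_two_iff (h2 _ hp).1).mp (h2 _ hp)
      obtain ⟨m, hm⟩ := ENNReal.exists_nat_gt hNp.ne
      refine tendsto_const_nhds.congr' ?_
      filter_upwards [eventually_ge_atTop m] with n hn
      have hp' : p ∈ A n ×ˢ (univ : Set (Rd d)) :=
        ⟨hm.le.trans (by exact_mod_cast hn), trivial⟩
      simp [hpt, indicator_of_mem hp']
  rw [lintegral_zero] at hlim
  obtain ⟨n, hn⟩ := (hlim.eventually_lt_const (ENNReal.pow_pos hε 2)).exists
  refine ⟨A n, hA n, hmem n, ?_⟩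
  rw [← sq_eLpNorm_two] at hn
  exact (ENNReal.pow_lt_pow_left_iff two_ne_zero).mp hn

/-- Truncation in time brings `ψ` into `L²` of the strip, where test functions are dense. By
Plancherel the `L²` norm dominates the weighted norm of order `γ ≤ 0`. -/
theorem exists_testFunction_approx {γ T : ℝ} (hγ : γ ≤ 0) {ψ : ℝ → Rd d → ℝ}
    (hψ : Measurable fun p : ℝ × Rd d => ψ p.1 p.2) (hi : ∀ t ∈ Icc 0 T, Integrable (ψ t))
    (h2 : ∀ t ∈ Icc 0 T, MemLp (ψ t) 2)
    (hfin : eLpNorm (wtd γ (sliceFourier ψ)) 2 (slab d T) < ∞) {ε : ℝ≥0∞} (hε : 0 < ε) :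
    ∃ η : 𝓓(strip d T, ℝ),
      eLpNorm (wtd γ (testFourier η) - wtd γ (sliceFourier ψ)) 2 (slab d T) < ε := by
  have hε2 : 0 < ε / 2 := ENNReal.half_pos hε.ne'
  obtain ⟨A, hA, hmem, hlt⟩ := exists_truncation hψ h2 hfin hε2
  have hmem' := hmem
  rw [slab_eq_restrict_strip] at hmem'
  obtain ⟨η, hη⟩ := TestFunction.exists_eLpNorm_sub_lt (Ω := strip d T) hmem' hε2
  refine ⟨η, ?_⟩
  rw [← slab_eq_restrict_strip] at hη
  have hmeas : Measurable fun p : ℝ × Rd d => A.indicator ψ p.1 p.2 := by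
    have : (fun p : ℝ × Rd d => A.indicator ψ p.1 p.2) =
        (A ×ˢ univ).indicator fun p => ψ p.1 p.2 := by
      ext p
      by_cases hp : p.1 ∈ A <;> simp [indicator, hp]
    rw [this]
    exact hψ.indicator (hA.prod MeasurableSet.univ)
  have hi' : ∀ t ∈ Icc 0 T, Integrable (A.indicator ψ t) := fun t ht => by
    by_cases h : t ∈ A
    · rw [indicator_of_mem h]; exact hi t ht
    · rw [indicator_of_notMem h]; exact integrable_zero _ _ _
  have h2' : ∀ t ∈ Icc 0 T, MemLp (A.indicator ψ t) 2 := fun t ht => by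
    by_cases h : t ∈ A
    · rw [indicator_of_mem h]; exact h2 t ht
    · rw [indicator_of_notMem h]; exact MemLp.zero
  have hle := eLpNorm_wtd_sliceFourier_le (T := T) hγ
    (ψ := fun s x => η (s, x) - A.indicator ψ s x) ((measurable_testFunction η).sub hmeas)
    (fun t ht => (integrable_slice η t).sub (hi' t ht))
    (fun t ht => (memLp_slice η t).sub (h2' t ht))
  have heq : wtd γ (testFourier η) - wtd γ (sliceFourier (A.indicator ψ)) =ᵐ[slab d T]
      wtd γ (sliceFourier fun s x => η (s, x) - A.indicator ψ s x) := by
    filter_upwards [ae_slab_mem T] with p hp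
    have := sliceFourier_sub (ψ := fun s x => η (s, x)) (η := A.indicator ψ)
      (integrable_slice η p.1) (hi' _ hp)
    simp only [wtd, Pi.sub_apply]
    rw [this, mul_sub]
    rfl
  rw [← eLpNorm_congr_ae heq] at hle
  calc _ = eLpNorm ((wtd γ (testFourier η) - wtd γ (sliceFourier (A.indicator ψ))) +
          (wtd γ (sliceFourier (A.indicator ψ)) - wtd γ (sliceFourier ψ))) 2 (slab d T) := by
        rw [sub_add_sub_cancel]
    _ ≤ _ := eLpNorm_add_le
        ((aemeasurable_wtd (measurable_sliceFourier (measurable_testFunction η)).aemeasurable).sub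
          (aemeasurable_wtd (measurable_sliceFourier hmeas).aemeasurable)).aestronglyMeasurable
        ((aemeasurable_wtd (measurable_sliceFourier hmeas).aemeasurable).sub
          (aemeasurable_wtd (measurable_sliceFourier hψ).aemeasurable)).aestronglyMeasurable
        one_le_two
    _ < ε / 2 + ε / 2 := ENNReal.add_lt_add (hle.trans_lt hη) hlt
    _ = ε := ENNReal.add_halves ε

/-! ### The heat kernel -/

theorem fourier_comp_sub_left (f : Rd d → ℂ) (x ξ : Rd d) :
    𝓕 (fun y => f (x - y)) ξ = (Real.fourierChar (-(inner ℝ x ξ)) : ℂ) * 𝓕 f (-ξ) := by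
  rw [Real.fourier_eq, Real.fourier_eq, ← integral_const_mul,
    ← integral_sub_left_eq_self _ volume x]
  refine integral_congr_ae (ae_of_all _ fun y => ?_)
  simp only [sub_sub_cancel, Circle.smul_def, smul_eq_mul, inner_neg_right, neg_neg]
  rw [← mul_assoc, ← Circle.coe_mul, ← AddChar.map_add_eq_mul, inner_sub_left]
  congr 3
  ring

/-- The Fourier transform of the heat kernel. -/
def heatSymb (t : ℝ) (ξ : Rd d) : ℝ :=
  if 0 < t then Real.exp (-((2 * Real.pi) ^ 2 * ‖ξ‖ ^ 2) * t) else 0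

theorem heatSymb_nonneg (t : ℝ) (ξ : Rd d) : 0 ≤ heatSymb t ξ := by
  unfold heatSymb; split_ifs <;> positivity

theorem heatSymb_le_one (t : ℝ) (ξ : Rd d) : heatSymb t ξ ≤ 1 := by
  unfold heatSymb
  split_ifs with h
  · rw [Real.exp_le_one_iff]
    have : 0 ≤ ((2 * Real.pi) ^ 2 * ‖ξ‖ ^ 2) * t := by positivity
    linarith
  · exact zero_le_one

theorem measurable_heatSymb : Measurable fun p : ℝ × Rd d => heatSymb p.1 p.2 := by
  unfold heatSymb
  refine Measurable.ite (measurableSet_lt measurable_const measurable_fst) ?_ measurable_const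
  fun_prop

theorem measurable_heatKernel : Measurable fun p : ℝ × Rd d => heatKernel p.1 p.2 := by
  unfold heatKernel
  refine Measurable.ite (measurableSet_lt measurable_const measurable_fst) ?_ measurable_const
  fun_prop

theorem heatKernel_of_nonpos {t : ℝ} (ht : t ≤ 0) : (heatKernel t : Rd d → ℝ) = 0 := by
  ext x; simp [heatKernel, ht.not_gt]

theorem heatKernel_nonneg (t : ℝ) (x : Rd d) : 0 ≤ heatKernel t x := by
  unfold heatKernel; split_ifs <;> positivity

theorem heatKernel_ofReal {t : ℝ} (ht : 0 < t) (x : Rd d) :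
    (heatKernel t x : ℂ) = (((4 * Real.pi * t) ^ (-(d : ℝ) / 2) : ℝ) : ℂ) *
      Complex.exp (-((1 / (4 * t) : ℝ) : ℂ) * ‖x‖ ^ 2) := by
  rw [heatKernel, if_pos ht]
  push_cast
  congr 2
  ring

theorem integrable_heatKernel (t : ℝ) : Integrable (heatKernel t : Rd d → ℝ) := by
  rcases lt_or_ge 0 t with ht | ht
  · have h := GaussianFourier.integrable_cexp_neg_mul_sq_norm_add (V := Rd d)
      (b := ((1 / (4 * t) : ℝ) : ℂ)) (by rw [Complex.ofReal_re]; positivity) 0 0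
    have h2 := (h.const_mul (((4 * Real.pi * t) ^ (-(d : ℝ) / 2) : ℝ) : ℂ)).re
    refine h2.congr (ae_of_all _ fun x => ?_)
    have := congrArg Complex.re (heatKernel_ofReal ht x)
    simp only [Complex.ofReal_re] at this
    rw [this]
    simp
  · rw [heatKernel_of_nonpos ht]; exact integrable_zero _ _ _

theorem heatKernel_le (t : ℝ) (x : Rd d) :
    heatKernel t x ≤ |(4 * Real.pi * t) ^ (-(d : ℝ) / 2)| := by
  unfold heatKernel
  split_ifs with ht
  · refine (mul_le_of_le_one_right (by positivity) ?_).trans (le_abs_self _)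
    rw [Real.exp_le_one_iff]
    exact div_nonpos_of_nonpos_of_nonneg (neg_nonpos.mpr (by positivity)) (by positivity)
  · positivity

theorem memLp_heatKernel (t : ℝ) : MemLp (heatKernel t : Rd d → ℝ) 2 := by
  have hi := integrable_heatKernel (d := d) t
  rw [memLp_two_iff_integrable_sq hi.1]
  refine (hi.const_mul |(4 * Real.pi * t) ^ (-(d : ℝ) / 2)|).mono' (hi.1.pow 2)
    (ae_of_all _ fun x => ?_)
  rw [Real.norm_of_nonneg (by positivity), sq]
  exact mul_le_mul_of_nonneg_right (heatKernel_le t x) (heatKernel_nonneg t x)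

theorem fourier_heatKernel (t : ℝ) (ξ : Rd d) :
    𝓕 (fun x : Rd d => (heatKernel t x : ℂ)) ξ = (heatSymb t ξ : ℂ) := by
  rcases lt_or_ge 0 t with ht | ht
  · have hb : 0 < ((1 / (4 * t) : ℝ) : ℂ).re := by rw [Complex.ofReal_re]; positivity
    have h := fourier_gaussian_innerProductSpace (V := Rd d) hb ξ
    have e : (fun x : Rd d => (heatKernel t x : ℂ)) =
        (((4 * Real.pi * t) ^ (-(d : ℝ) / 2) : ℝ) : ℂ) •
          fun x : Rd d => Complex.exp (-((1 / (4 * t) : ℝ) : ℂ) * ‖x‖ ^ 2) := by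
      ext x; rw [heatKernel_ofReal ht]; rfl
    have e2 : 𝓕 (fun x : Rd d => (heatKernel t x : ℂ)) = (((4 * Real.pi * t) ^ (-(d : ℝ) / 2) : ℝ) : ℂ) •
        𝓕 (fun x : Rd d => Complex.exp (-((1 / (4 * t) : ℝ) : ℂ) * ‖x‖ ^ 2)) := by
      rw [e]
      exact VectorFourier.fourierIntegral_const_smul _ _ _ _ _
    rw [e2, Pi.smul_apply, h, smul_eq_mul, heatSymb, if_pos ht, ← mul_assoc]
    -- The Gaussian formula contributes this base to the power `d/2`, which cancels the
    -- normalization of the heat kernel.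
    have e3 : ((Real.pi : ℂ) / ((1 / (4 * t) : ℝ) : ℂ)) = ((4 * Real.pi * t : ℝ) : ℂ) := by
      push_cast
      field_simp
    rw [e3, finrank_euclideanSpace_fin,
      show ((d : ℂ) / 2) = (((d : ℝ) / 2 : ℝ) : ℂ) by push_cast; rfl,
      ← Complex.ofReal_cpow (by positivity), ← Complex.ofReal_mul, ← Real.rpow_add (by positivity)]
    rw [show -(d : ℝ) / 2 + d / 2 = 0 by ring, Real.rpow_zero, Complex.ofReal_one, one_mul]
    push_cast
    congr 1
    have : (t : ℂ) ≠ 0 := by exact_mod_cast ht.ne'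
    field_simp
    ring
  · have : (fun x : Rd d => (heatKernel t x : ℂ)) = 0 := by
      ext x; rw [heatKernel_of_nonpos ht]; simp
    rw [this, heatSymb, if_neg ht.not_gt, Real.fourier_eq]
    simp

theorem heatSymb_neg (t : ℝ) (ξ : Rd d) : heatSymb t (-ξ) = heatSymb t ξ := by
  simp [heatSymb]

/-- The integrand `g_{tx}` of the process solution. -/
def heatSlice (t : ℝ) (x : Rd d) (s : ℝ) (y : Rd d) : ℝ := heatKernel (t - s) (x - y)

theorem measurable_heatSlice (t : ℝ) (x : Rd d) :
    Measurable fun p : ℝ × Rd d => heatSlice t x p.1 p.2 :=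
  measurable_heatKernel.comp
    ((measurable_const.sub measurable_fst).prodMk (measurable_const.sub measurable_snd))

theorem integrable_heatSlice (t : ℝ) (x : Rd d) (s : ℝ) : Integrable (heatSlice t x s) :=
  (integrable_heatKernel (t - s)).comp_sub_left x

theorem memLp_heatSlice (t : ℝ) (x : Rd d) (s : ℝ) : MemLp (heatSlice t x s) 2 :=
  (memLp_heatKernel (t - s)).comp_measurePreserving (Measure.measurePreserving_sub_left volume x)

theorem sliceFourier_heatSlice (t : ℝ) (x : Rd d) (s : ℝ) (ξ : Rd d) :
    sliceFourier (heatSlice t x) s ξ =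
      (Real.fourierChar (-(inner ℝ x ξ)) : ℂ) * (heatSymb (t - s) ξ : ℂ) := by
  rw [← heatSymb_neg, ← fourier_heatKernel, ← fourier_comp_sub_left
    (fun y => (heatKernel (t - s) y : ℂ))]
  rfl

theorem lintegral_exp_neg_mul_Ioi {c : ℝ} (hc : 0 < c) :
    ∫⁻ r in Ioi (0 : ℝ), ENNReal.ofReal (Real.exp (-c * r)) = ENNReal.ofReal c⁻¹ := by
  rw [← ofReal_integral_eq_lintegral_ofReal]
  · rw [integral_exp_mul_Ioi (by linarith : -c < 0) 0]
    congr 1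
    simp
  · exact integrableOn_exp_mul_Ioi (by linarith) 0
  · exact ae_of_all _ fun r => by positivity

/-- Since `exp(-4π²|ξ|² t) = e^t exp(-symb ξ * t)`, a factor `e^T` replaces the decay rate
`4π²|ξ|²`, which degenerates at `ξ = 0`, by `symb ξ ≥ 1`. The majorant has total mass `e^T / symb ξ`
on the half line. -/
theorem heatSymb_le_of_le {T t : ℝ} (ht : t ≤ T) (ξ : Rd d) :
    ENNReal.ofReal (heatSymb t ξ) ≤ ENNReal.ofReal (Real.exp T) *
      (Ioi (0 : ℝ)).indicator (fun r => ENNReal.ofReal (Real.exp (-symb ξ * r))) t := by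
  unfold heatSymb
  split_ifs with h
  · rw [indicator_of_mem (mem_Ioi.mpr h), ← ENNReal.ofReal_mul (by positivity), ← Real.exp_add]
    refine ENNReal.ofReal_le_ofReal (Real.exp_le_exp.mpr ?_)
    unfold symb
    nlinarith
  · simp

theorem lintegral_indicator_exp (ξ : Rd d) :
    ∫⁻ t, (Ioi (0 : ℝ)).indicator (fun r => ENNReal.ofReal (Real.exp (-symb ξ * r))) t =
      ENNReal.ofReal (symb ξ)⁻¹ := by
  rw [lintegral_indicator measurableSet_Ioi, lintegral_exp_neg_mul_Ioi (symb_pos ξ)]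

theorem lintegral_heatSymb_sub_le {T t : ℝ} (ht : t ≤ T) (ξ : Rd d) :
    ∫⁻ s in Icc 0 T, ENNReal.ofReal (heatSymb (t - s) ξ) ≤
      ENNReal.ofReal (Real.exp T) * ENNReal.ofReal (symb ξ)⁻¹ := by
  refine (setLIntegral_mono' measurableSet_Icc fun s hs =>
    heatSymb_le_of_le (T := T) (t := t - s) (by linarith [hs.1]) ξ).trans ?_
  rw [lintegral_const_mul' _ _ ENNReal.ofReal_ne_top]
  refine mul_le_mul_right ((setLIntegral_le_lintegral _ _).trans (le_of_eq ?_)) _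
  rw [lintegral_sub_left_eq_self (fun r => (Ioi (0 : ℝ)).indicator
    (fun r => ENNReal.ofReal (Real.exp (-symb ξ * r))) r) t, lintegral_indicator_exp]

/-- The companion bound, with the other time variable integrated. A Schur test needs both. -/
theorem lintegral_heatSymb_sub_le' {T s : ℝ} (hs : 0 ≤ s) (ξ : Rd d) :
    ∫⁻ t in Icc 0 T, ENNReal.ofReal (heatSymb (t - s) ξ) ≤
      ENNReal.ofReal (Real.exp T) * ENNReal.ofReal (symb ξ)⁻¹ := by
  refine (setLIntegral_mono' measurableSet_Icc fun t ht =>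
    heatSymb_le_of_le (T := T) (t := t - s) (by linarith [ht.2]) ξ).trans ?_
  rw [lintegral_const_mul' _ _ ENNReal.ofReal_ne_top]
  refine mul_le_mul_right ((setLIntegral_le_lintegral _ _).trans (le_of_eq ?_)) _
  rw [lintegral_sub_right_eq_self (fun r => (Ioi (0 : ℝ)).indicator
    (fun r => ENNReal.ofReal (Real.exp (-symb ξ * r))) r) s, lintegral_indicator_exp]

theorem lintegral_symb_rpow_lt_top {s : ℝ} (hs : (d : ℝ) < 2 * s) :
    ∫⁻ ξ : Rd d, ENNReal.ofReal (symb ξ ^ (-s)) < ∞ := by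
  have h := integrable_rpow_neg_one_add_norm_sq (E := Rd d) (μ := volume) (r := 2 * s)
    (by simpa using hs)
  refine lt_of_le_of_lt (lintegral_mono fun ξ => ?_) h.lintegral_lt_top
  refine ENNReal.ofReal_le_ofReal ?_
  rw [show -(2 * s) / 2 = -s by ring]
  refine Real.rpow_le_rpow_of_nonpos (by positivity) ?_ ?_
  · unfold symb
    have : (1 : ℝ) ≤ (2 * Real.pi) ^ 2 := by nlinarith [Real.pi_gt_three]
    nlinarith [sq_nonneg ‖ξ‖]
  · have : (0 : ℝ) ≤ d := by positivity
    linarith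

/-- The character has modulus one and `heatSymb ^ 2 ≤ heatSymb`. Integration in time therefore
leaves a multiple of `symb ξ ^ (-(α / 2 + 1))`, which is integrable because `d < α + 2`. -/
theorem eLpNorm_wtd_heatSlice_lt_top {α T t : ℝ} (hα : (d : ℝ) - 2 < α) (ht : t ≤ T)
    (x : Rd d) : eLpNorm (wtd (-α / 2) (sliceFourier (heatSlice t x))) 2 (slab d T) < ∞ := by
  suffices h : eLpNorm (wtd (-α / 2) (sliceFourier (heatSlice t x))) 2 (slab d T) ^ 2 < ∞ by
    simpa using h
  rw [sq_eLpNorm_wtd (measurable_sliceFourier (measurable_heatSlice t x)).aemeasurable]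
  have hm : Measurable fun p : ℝ × Rd d => ENNReal.ofReal (heatSymb (t - p.1) p.2) *
      ENNReal.ofReal (symb p.2 ^ (-α / 2)) :=
    (measurable_heatSymb.comp ((measurable_const.sub measurable_fst).prodMk
      measurable_snd)).ennreal_ofReal.mul
      ((continuous_symb_rpow _).measurable.comp measurable_snd).ennreal_ofReal
  calc ∫⁻ s in Icc 0 T, weightedSq (-α / 2) (sliceFourier (heatSlice t x) s)
      ≤ ∫⁻ s in Icc 0 T, ∫⁻ ξ, ENNReal.ofReal (heatSymb (t - s) ξ) *
          ENNReal.ofReal (symb ξ ^ (-α / 2)) := by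
        refine lintegral_mono fun s => lintegral_mono fun ξ => ?_
        refine mul_le_mul_left ?_ _
        rw [sliceFourier_heatSlice, ← ofReal_norm, norm_mul, Circle.norm_coe, one_mul,
          Complex.norm_real, Real.norm_of_nonneg (heatSymb_nonneg _ _),
          ← ENNReal.ofReal_pow (heatSymb_nonneg _ _)]
        exact ENNReal.ofReal_le_ofReal
          (pow_le_of_le_one (heatSymb_nonneg _ _) (heatSymb_le_one _ _) two_ne_zero)
    _ = ∫⁻ ξ, (∫⁻ s in Icc 0 T, ENNReal.ofReal (heatSymb (t - s) ξ)) *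
          ENNReal.ofReal (symb ξ ^ (-α / 2)) := by
        rw [lintegral_lintegral_swap hm.aemeasurable]
        refine lintegral_congr fun ξ => ?_
        rw [lintegral_mul_const' _ _ ENNReal.ofReal_ne_top]
    _ ≤ ∫⁻ ξ : Rd d, ENNReal.ofReal (Real.exp T) *
          ENNReal.ofReal (symb ξ ^ (-(α / 2 + 1))) := by
        refine lintegral_mono fun ξ => ?_
        refine (mul_le_mul_left (lintegral_heatSymb_sub_le ht ξ) _).trans (le_of_eq ?_)
        rw [mul_assoc, ← ENNReal.ofReal_mul (inv_nonneg.mpr (symb_pos ξ).le),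
          ← Real.rpow_neg_one, ← Real.rpow_add (symb_pos ξ)]
        congr 3; ring
    _ < ∞ := by
        rw [lintegral_const_mul' _ _ ENNReal.ofReal_ne_top]
        exact ENNReal.mul_lt_top ENNReal.ofReal_lt_top
          (lintegral_symb_rpow_lt_top (by linarith))

/-! ### The Bessel kernel -/

theorem integral_heatKernel {t : ℝ} (ht : 0 < t) : ∫ x : Rd d, heatKernel t x = 1 := by
  have h := fourier_heatKernel (d := d) t 0
  rw [Real.fourier_eq] at h
  simp only [inner_zero_right, neg_zero, AddChar.map_zero_eq_one, one_smul] at h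
  rw [integral_complex_ofReal] at h
  have h' := Complex.ofReal_injective h
  rw [h', heatSymb, if_pos ht]
  simp

/-- The subordination formula for the Bessel kernel. -/
theorem besselKernel_eq_integral_heatKernel (α : ℝ) (x : Rd d) :
    besselKernel d α x = (Real.Gamma (α / 2))⁻¹ *
      ∫ τ in Ioi (0 : ℝ), τ ^ (α / 2 - 1) * Real.exp (-τ) * heatKernel τ x := by
  rw [besselKernel, mul_inv, mul_comm (((4 * Real.pi) ^ ((d : ℝ) / 2))⁻¹), mul_assoc]
  congr 1
  rw [← integral_const_mul]
  refine setIntegral_congr_fun measurableSet_Ioi fun τ (hτ : 0 < τ) => ?_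
  simp only [heatKernel, if_pos hτ]
  have e1 : (4 * Real.pi * τ) ^ (-(d : ℝ) / 2) =
      ((4 * Real.pi) ^ ((d : ℝ) / 2))⁻¹ * τ ^ (-(d : ℝ) / 2) := by
    rw [Real.mul_rpow (by positivity) hτ.le, ← Real.rpow_neg (by positivity)]
    congr 2; ring
  have e2 : τ ^ ((α - d) / 2 - 1) = τ ^ (α / 2 - 1) * τ ^ (-(d : ℝ) / 2) := by
    rw [← Real.rpow_add hτ]; congr 1; ring
  have e3 : Real.exp (-τ - ‖x‖ ^ 2 / (4 * τ)) = Real.exp (-τ) * Real.exp (-‖x‖ ^ 2 / (4 * τ)) := by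
    rw [← Real.exp_add]; congr 1; ring
  rw [e1, e2, e3]
  ring

theorem integrableOn_gammaIntegrand {α : ℝ} (hα : 0 < α) :
    IntegrableOn (fun τ : ℝ => τ ^ (α / 2 - 1) * Real.exp (-τ)) (Ioi 0) := by
  have := Real.GammaIntegral_convergent (half_pos hα)
  exact this.congr_fun (fun τ _ => mul_comm _ _) measurableSet_Ioi

/-- The integrand is nonnegative on `τ > 0` and each heat kernel has mass one, so this reduces to
convergence of the Gamma integral. It justifies Fubini in the subordination formula. -/
theorem integrable_bessel_prod {α : ℝ} (hα : 0 < α) :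
    Integrable (fun p : ℝ × Rd d => p.1 ^ (α / 2 - 1) * Real.exp (-p.1) * heatKernel p.1 p.2)
      ((volume.restrict (Ioi 0)).prod volume) := by
  have hm : Measurable fun p : ℝ × Rd d =>
      p.1 ^ (α / 2 - 1) * Real.exp (-p.1) * heatKernel p.1 p.2 := by
    refine Measurable.mul ?_ measurable_heatKernel
    fun_prop
  rw [integrable_prod_iff hm.aestronglyMeasurable]
  refine ⟨ae_of_all _ fun τ =>
    (integrable_heatKernel τ).const_mul (τ ^ (α / 2 - 1) * Real.exp (-τ)), ?_⟩
  refine (integrableOn_gammaIntegrand hα).congr_fun (fun τ (hτ : 0 < τ) => ?_) measurableSet_Ioi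
  have : ∀ y : Rd d, ‖τ ^ (α / 2 - 1) * Real.exp (-τ) * heatKernel τ y‖ =
      τ ^ (α / 2 - 1) * Real.exp (-τ) * heatKernel τ y := fun y =>
    Real.norm_of_nonneg (mul_nonneg (by positivity) (heatKernel_nonneg τ y))
  simp only [this]
  rw [integral_const_mul, integral_heatKernel hτ, mul_one]

theorem integrable_besselKernel {α : ℝ} (hα : 0 < α) : Integrable (besselKernel d α) := by
  have h := (integrable_bessel_prod (d := d) hα).integral_prod_right
  refine (h.const_mul (Real.Gamma (α / 2))⁻¹).congr (ae_of_all _ fun x => ?_)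
  exact (besselKernel_eq_integral_heatKernel α x).symm

/-- The factor `e^{-τ}` combines with `heatSymb` to `exp(-symb ξ * τ)`, leaving a rescaled Gamma
integral. -/
theorem integral_gamma_heatSymb {α : ℝ} (hα : 0 < α) (ξ : Rd d) :
    ∫ τ in Ioi (0 : ℝ), τ ^ (α / 2 - 1) * Real.exp (-τ) * heatSymb τ ξ =
      Real.Gamma (α / 2) * symb ξ ^ (-α / 2) := by
  have h := Real.integral_rpow_mul_exp_neg_mul_Ioi (half_pos hα) (symb_pos ξ)
  rw [one_div, Real.inv_rpow (symb_pos ξ).le, ← Real.rpow_neg (symb_pos ξ).le, mul_comm,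
    show -(α / 2) = -α / 2 by ring] at h
  rw [← h]
  refine setIntegral_congr_fun measurableSet_Ioi fun τ (hτ : 0 < τ) => ?_
  simp only [heatSymb, if_pos hτ]
  rw [mul_assoc, ← Real.exp_add]
  congr 2
  unfold symb
  ring

/-- The Fourier transform of the Bessel kernel. -/
theorem fourier_besselKernel {α : ℝ} (hα : 0 < α) (ξ : Rd d) :
    𝓕 (fun x : Rd d => (besselKernel d α x : ℂ)) ξ = ((symb ξ ^ (-α / 2) : ℝ) : ℂ) := by
  have hG : Real.Gamma (α / 2) ≠ 0 := (Real.Gamma_pos_of_pos (half_pos hα)).ne'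
  have hch : Continuous fun x : Rd d => ((Real.fourierChar (-(inner ℝ x ξ)) : Circle) : ℂ) :=
    continuous_subtype_val.comp (Real.continuous_fourierChar.comp (by fun_prop))
  have hint : Integrable (fun p : Rd d × ℝ => ((Real.fourierChar (-(inner ℝ p.1 ξ)) : Circle) : ℂ) *
      ((p.2 ^ (α / 2 - 1) * Real.exp (-p.2) * heatKernel p.2 p.1 : ℝ) : ℂ))
      (volume.prod (volume.restrict (Ioi 0))) := by
    refine ((integrable_bessel_prod (d := d) hα).swap.ofReal).bdd_mul (c := 1)
      (hch.comp continuous_fst).aestronglyMeasurable (ae_of_all _ fun p => ?_)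
    exact (Circle.norm_coe _).le
  have key : ∫ x, ((Real.fourierChar (-(inner ℝ x ξ)) : Circle) : ℂ) *
      ((∫ τ in Ioi (0 : ℝ), τ ^ (α / 2 - 1) * Real.exp (-τ) * heatKernel τ x : ℝ) : ℂ) =
      ((Real.Gamma (α / 2) * symb ξ ^ (-α / 2) : ℝ) : ℂ) := by
    calc _ = ∫ x, ∫ τ in Ioi (0 : ℝ), ((Real.fourierChar (-(inner ℝ x ξ)) : Circle) : ℂ) *
          ((τ ^ (α / 2 - 1) * Real.exp (-τ) * heatKernel τ x : ℝ) : ℂ) := by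
          congr 1 with x
          rw [integral_const_mul, integral_complex_ofReal]
      _ = ∫ τ in Ioi (0 : ℝ), ∫ x, ((Real.fourierChar (-(inner ℝ x ξ)) : Circle) : ℂ) *
          ((τ ^ (α / 2 - 1) * Real.exp (-τ) * heatKernel τ x : ℝ) : ℂ) :=
          integral_integral_swap hint
      _ = ∫ τ in Ioi (0 : ℝ), ((τ ^ (α / 2 - 1) * Real.exp (-τ) * heatSymb τ ξ : ℝ) : ℂ) := by
          congr 1 with τ
          rw [Complex.ofReal_mul _ (heatSymb τ ξ), ← fourier_heatKernel, Real.fourier_eq,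
            ← integral_const_mul]
          congr 1 with x
          rw [Circle.smul_def, smul_eq_mul, Complex.ofReal_mul _ (heatKernel τ x)]
          ring
      _ = _ := by rw [integral_complex_ofReal, integral_gamma_heatSymb hα]
  rw [Real.fourier_eq]
  calc _ = ((Real.Gamma (α / 2))⁻¹ : ℂ) * ∫ x, ((Real.fourierChar (-(inner ℝ x ξ)) : Circle) : ℂ) *
      ((∫ τ in Ioi (0 : ℝ), τ ^ (α / 2 - 1) * Real.exp (-τ) * heatKernel τ x : ℝ) : ℂ) := by
        rw [← integral_const_mul]
        congr 1 with x
        rw [besselKernel_eq_integral_heatKernel, Circle.smul_def, smul_eq_mul]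
        push_cast
        ring
    _ = _ := by
        rw [key]
        push_cast
        rw [← mul_assoc, inv_mul_cancel₀ (by exact_mod_cast hG), one_mul]

theorem conj_fourier_ofReal (g : Rd d → ℝ) (ξ : Rd d) :
    (starRingEnd ℂ) (𝓕 (fun x => (g x : ℂ)) ξ) = 𝓕 (fun x => (g x : ℂ)) (-ξ) := by
  rw [Real.fourier_eq, Real.fourier_eq, ← integral_conj]
  congr 1 with x
  simp only [Circle.smul_def, smul_eq_mul, map_mul, Complex.conj_ofReal, inner_neg_right]
  rw [← Circle.coe_inv_eq_conj, ← AddChar.map_neg_eq_inv]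

/-- The covariance form on the Fourier side. -/
theorem integral_besselKernel_eq {α : ℝ} (hα : 0 < α) {u v : Rd d → ℝ}
    (hu : HasCompactSupport u) (hus : ContDiff ℝ (⊤ : ℕ∞) u) (hv : Integrable v) :
    ((∫ x, ∫ y, u x * besselKernel d α (x - y) * v y : ℝ) : ℂ) =
      ∫ ξ, (starRingEnd ℂ) (𝓕 (fun x => (v x : ℂ)) ξ) * 𝓕 (fun x => (u x : ℂ)) ξ *
        ((symb ξ ^ (-α / 2) : ℝ) : ℂ) := by
  have hc : HasCompactSupport fun x => (u x : ℂ) := hu.comp_left (g := fun r : ℝ => (r : ℂ)) rfl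
  have hs : ContDiff ℝ (⊤ : ℕ∞) fun x => (u x : ℂ) := Complex.ofRealCLM.contDiff.comp hus
  let U : 𝓢(Rd d, ℂ) := hc.toSchwartzMap hs
  have hU : ∀ x, U x = (u x : ℂ) := fun x => rfl
  let C : Rd d → ℂ := convolution (fun x => (v x : ℂ)) (fun x => (besselKernel d α x : ℂ))
    (ContinuousLinearMap.mul ℂ ℂ) volume
  have hv' : Integrable fun x => (v x : ℂ) := hv.ofReal
  have hB : Integrable fun x : Rd d => (besselKernel d α x : ℂ) :=
    (integrable_besselKernel hα).ofReal
  have hC : Integrable C := Integrable.integrable_convolution _ hv' hB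
  have hCx : ∀ x, C x = ((∫ y, besselKernel d α (x - y) * v y : ℝ) : ℂ) := fun x => by
    rw [← integral_complex_ofReal]
    refine integral_congr_ae (ae_of_all _ fun y => ?_)
    simp only [ContinuousLinearMap.mul_apply', Complex.ofReal_mul]
    ring
  -- Inversion is applied only to the Schwartz function `U`. The convolution `C` is known merely to
  -- be integrable, so its transform is reached by duality.
  have hinv : (𝓕⁻ ((𝓕 U : 𝓢(Rd d, ℂ)) : Rd d → ℂ)) = U := by
    rw [← SchwartzMap.fourierInv_coe, FourierTransform.fourierInv_fourier_eq]
  calc ((∫ x, ∫ y, u x * besselKernel d α (x - y) * v y : ℝ) : ℂ)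
      = ∫ x, U x * C x := by
        rw [← integral_complex_ofReal]
        refine integral_congr_ae (ae_of_all _ fun x => ?_)
        simp only [hU, hCx, ← Complex.ofReal_mul, ← integral_const_mul, mul_assoc]
    _ = ∫ x, 𝓕⁻ ((𝓕 U : 𝓢(Rd d, ℂ)) : Rd d → ℂ) x * C x := by rw [hinv]
    _ = ∫ ξ, (𝓕 U : 𝓢(Rd d, ℂ)) ξ * 𝓕⁻ C ξ :=
        integral_fourierInv_mul_eq (SchwartzMap.integrable _) hC
    _ = _ := by
        refine integral_congr_ae (ae_of_all _ fun ξ => ?_)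
        have h1 : symb (-ξ) = symb ξ := by simp [symb]
        simp only [Real.fourierInv_eq_fourier_neg]
        rw [Real.fourier_mul_convolution_eq hv' hB, fourier_besselKernel hα, h1,
          conj_fourier_ofReal]
        change 𝓕 (fun x => (u x : ℂ)) ξ * _ = _
        ring

theorem memLp_testFunction_slab {T : ℝ} (η : 𝓓(strip d T, ℝ)) :
    MemLp (fun p : ℝ × Rd d => η (p.1, p.2)) 2 (slab d T) := by
  rw [slab_eq_restrict_strip]
  exact TestFunction.memLp_restrict η

theorem memLp_wtd_testFourier {γ T : ℝ} (hγ : γ ≤ 0) (η : 𝓓(strip d T, ℝ)) :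
    MemLp (wtd γ (testFourier η)) 2 (slab d T) :=
  ⟨(aemeasurable_wtd (fourierRep_testFunction η).aemeasurable).aestronglyMeasurable,
    (eLpNorm_wtd_sliceFourier_le hγ (measurable_testFunction η) (fun t _ => integrable_slice η t)
      fun t _ => memLp_slice η t).trans_lt (memLp_testFunction_slab η).2⟩

/-- The covariance of the noise is the inner product of the Fourier transforms. -/
theorem noiseCov_eq_inner {α T : ℝ} (hα : 0 < α) (φ ψ : 𝓓(strip d T, ℝ)) :
    ((noiseCov (besselKernel d α) T φ ψ : ℝ) : ℂ) =
      ∫ p, inner ℂ (wtd (-α / 2) (testFourier ψ) p) (wtd (-α / 2) (testFourier φ) p)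
        ∂(slab d T) := by
  have hγ : -α / 2 ≤ 0 := by linarith
  rw [integral_prod]
  · rw [noiseCov, ← integral_complex_ofReal, ← Measure.restrict_congr_set Ioo_ae_eq_Icc]
    refine integral_congr_ae (ae_of_all _ fun t => ?_)
    have hs : ContDiff ℝ (⊤ : ℕ∞) fun x => φ (t, x) :=
      φ.contDiff.comp (contDiff_const.prodMk contDiff_id)
    simp only
    rw [integral_besselKernel_eq hα (hasCompactSupport_slice φ t) hs (integrable_slice ψ t)]
    refine integral_congr_ae (ae_of_all _ fun ξ => ?_)
    simp only [wtd, RCLike.inner_apply, map_mul, Complex.conj_ofReal]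
    have h1 : ((symb ξ ^ (-α / 2) : ℝ) : ℂ) = ((symb ξ ^ (-α / 2 / 2) : ℝ) : ℂ) *
        ((symb ξ ^ (-α / 2 / 2) : ℝ) : ℂ) := by
      rw [← Complex.ofReal_mul, ← Real.rpow_add (symb_pos ξ)]
      congr 2; ring
    rw [h1, testFourier, testFourier, sliceFourier, sliceFourier]
    ring
  · exact (memLp_wtd_testFourier hγ φ).integrable_mul (memLp_wtd_testFourier hγ ψ).star

/-! ### The stochastic integral -/

/-- `φ`, with Fourier transforms `k`, is a limit of test functions in the norm `‖·‖_0`. -/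
structure IsApproximable (α T : ℝ) (φ : ℝ → TD d) (k : ℝ → Rd d → ℂ) : Prop where
  rep : FourierRep T φ k
  memLp : MemLp (wtd (-α / 2) k) 2 (slab d T)
  approx : ∀ ε : ℝ≥0∞, 0 < ε → ∃ η : 𝓓(strip d T, ℝ),
    eLpNorm (wtd (-α / 2) (testFourier η) - wtd (-α / 2) k) 2 (slab d T) < ε

theorem isApproximable_slices {α T : ℝ} (hα : 0 < α) {ψ : ℝ → Rd d → ℝ}
    (hψ : Measurable fun p : ℝ × Rd d => ψ p.1 p.2) (hi : ∀ t ∈ Icc 0 T, Integrable (ψ t))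
    (h2 : ∀ t ∈ Icc 0 T, MemLp (ψ t) 2)
    (hfin : eLpNorm (wtd (-α / 2) (sliceFourier ψ)) 2 (slab d T) < ∞) :
    IsApproximable α T (slices ψ) (sliceFourier ψ) where
  rep := fourierRep_slices hψ hi
  memLp := ⟨(aemeasurable_wtd (measurable_sliceFourier hψ).aemeasurable).aestronglyMeasurable, hfin⟩
  approx := fun _ hε => exists_testFunction_approx (by linarith) hψ hi h2 hfin hε

theorem isApproximable_heatSlice {α T t : ℝ} (hα : 0 < α) (hd : (d : ℝ) - 2 < α) (ht : t ≤ T)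
    (x : Rd d) :
    IsApproximable α T (slices (heatSlice t x)) (sliceFourier (heatSlice t x)) :=
  isApproximable_slices hα (measurable_heatSlice t x) (fun s _ => integrable_heatSlice t x s)
    (fun s _ => memLp_heatSlice t x s) (eLpNorm_wtd_heatSlice_lt_top hd ht x)

/-- Two approximations are chained: `φ` by an element of `EZero`, whose Schwartz slices are
integrable and square integrable, and that element by a test function. -/
theorem isApproximable_of_mem_PZero {α T : ℝ} (hα : 0 < α) {φ : ℝ → TD d}
    (hφ : φ ∈ PZero d α T) :
    ∃ k : ℝ → Rd d → ℂ, IsApproximable α T φ k := by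
  obtain ⟨⟨⟨k, hk, hd⟩, hfin⟩, happ⟩ := hφ
  have hrep : FourierRep T φ k :=
    ⟨hk, (ae_restrict_iff' measurableSet_Icc).mpr (ae_of_all _ hd)⟩
  have hm : AEStronglyMeasurable (wtd (-α / 2) k) (slab d T) :=
    (aemeasurable_wtd hk).aestronglyMeasurable
  have hLp : MemLp (wtd (-α / 2) k) 2 (slab d T) := by
    refine ⟨hm, ?_⟩
    rw [hrep.normZeroSq_eq] at hfin
    simpa using hfin
  refine ⟨k, hrep, hLp, fun ε hε => ?_⟩
  have hε2 : 0 < ε / 2 := ENNReal.half_pos hε.ne'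
  obtain ⟨ψ, ⟨⟨hψ, -⟩, hS⟩, hlt⟩ := happ ((ε / 2) ^ 2) (ENNReal.pow_pos hε2 2)
  have hi : ∀ t ∈ Icc 0 T, Integrable (ψ t) := fun t ht => by
    obtain ⟨s, hs⟩ := hS t ht
    rw [show ψ t = s from (funext hs).symm]
    exact s.integrable
  have h2 : ∀ t ∈ Icc 0 T, MemLp (ψ t) 2 := fun t ht => by
    obtain ⟨s, hs⟩ := hS t ht
    rw [show ψ t = s from (funext hs).symm]
    exact s.memLp 2
  have hψm : AEStronglyMeasurable (wtd (-α / 2) (sliceFourier ψ)) (slab d T) :=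
    (aemeasurable_wtd (measurable_sliceFourier hψ).aemeasurable).aestronglyMeasurable
  rw [hrep.normZeroSq_sub_eq (fourierRep_slices hψ hi),
    ENNReal.pow_lt_pow_left_iff two_ne_zero, eLpNorm_sub_comm] at hlt
  -- The norm of `ψ` is finite because `ψ` is within finite distance of `φ`.
  have hψfin : eLpNorm (wtd (-α / 2) (sliceFourier ψ)) 2 (slab d T) < ∞ := by
    have : eLpNorm ((wtd (-α / 2) (sliceFourier ψ) - wtd (-α / 2) k) + wtd (-α / 2) k) 2
        (slab d T) < ∞ :=
      (eLpNorm_add_le (hψm.sub hm) hm one_le_two).trans_lt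
        (ENNReal.add_lt_top.mpr ⟨hlt.trans_le le_top, hLp.2⟩)
    rwa [sub_add_cancel] at this
  obtain ⟨η, hη⟩ := exists_testFunction_approx (by linarith : -α / 2 ≤ 0) hψ hi h2 hψfin hε2
  refine ⟨η, ?_⟩
  have hηm : AEStronglyMeasurable (wtd (-α / 2) (testFourier η)) (slab d T) :=
    (aemeasurable_wtd (fourierRep_testFunction η).aemeasurable).aestronglyMeasurable
  calc _ = eLpNorm ((wtd (-α / 2) (testFourier η) - wtd (-α / 2) (sliceFourier ψ)) +
        (wtd (-α / 2) (sliceFourier ψ) - wtd (-α / 2) k)) 2 (slab d T) := by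
        rw [sub_add_sub_cancel]
    _ ≤ _ := eLpNorm_add_le (hηm.sub hψm) (hψm.sub hm) one_le_two
    _ < ε / 2 + ε / 2 := ENNReal.add_lt_add hη hlt
    _ = ε := ENNReal.add_halves ε

section noise

variable {α T : ℝ} {Ω : Type*} [MeasurableSpace Ω] {P : Measure Ω}
  {F : 𝓓(strip d T, ℝ) → Ω → ℝ}

theorem IsGaussianNoise.memLp {f : Rd d → ℝ} (hF : IsGaussianNoise f T P F)
    (φ : 𝓓(strip d T, ℝ)) : MemLp (F φ) 2 P :=
  (hF.gaussian.hasGaussianLaw_eval φ).memLp (by norm_num)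

/-- The noise as an element of `L²(Ω)`. -/
def noiseLp {f : Rd d → ℝ} (hF : IsGaussianNoise f T P F) (φ : 𝓓(strip d T, ℝ)) : Lp ℝ 2 P :=
  (hF.memLp φ).toLp _

/-- The weighted Fourier transform of a test function as an element of `L²`. -/
def fourierLp (hα : 0 < α) (φ : 𝓓(strip d T, ℝ)) : Lp ℂ 2 (slab d T) :=
  (memLp_wtd_testFourier (by linarith : -α / 2 ≤ 0) φ).toLp _

theorem inner_toLp {X : Type*} [MeasurableSpace X] {𝕜 : Type*} [RCLike 𝕜] {μ : Measure X}
    {f g : X → 𝕜} (hf : MemLp f 2 μ) (hg : MemLp g 2 μ) :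
    inner 𝕜 (hf.toLp f) (hg.toLp g) = ∫ x, inner 𝕜 (f x) (g x) ∂μ := by
  rw [L2.inner_def]
  refine integral_congr_ae ?_
  filter_upwards [hf.coeFn_toLp, hg.coeFn_toLp] with x h1 h2
  rw [h1, h2]

/-- The order of the arguments flips because the complex inner product is conjugate linear in its
first slot. -/
theorem inner_noiseLp (hα : 0 < α) (hF : IsGaussianNoise (besselKernel d α) T P F)
    (φ ψ : 𝓓(strip d T, ℝ)) :
    ((inner ℝ (noiseLp hF φ) (noiseLp hF ψ) : ℝ) : ℂ) =
      inner ℂ (fourierLp hα ψ) (fourierLp hα φ) := by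
  rw [noiseLp, noiseLp, inner_toLp, fourierLp, fourierLp, inner_toLp, ← noiseCov_eq_inner hα,
    ← hF.covariance]
  simp [mul_comm]

/-- Linearity of `F` is not part of the definition of the noise, so distances are compared by
expanding the squared norm of a difference into inner products, which are known to match. -/
theorem norm_noiseLp_sub (hα : 0 < α) (hF : IsGaussianNoise (besselKernel d α) T P F)
    (φ ψ : 𝓓(strip d T, ℝ)) :
    ‖noiseLp hF φ - noiseLp hF ψ‖ = ‖fourierLp hα φ - fourierLp hα ψ‖ := by
  have h : ∀ a b, inner ℝ (noiseLp hF a) (noiseLp hF b) =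
      RCLike.re (inner ℂ (fourierLp hα b) (fourierLp hα a)) := fun a b => by
    rw [← inner_noiseLp hα hF]; rfl
  have hn : ∀ a, ‖noiseLp hF a‖ ^ 2 = ‖fourierLp hα a‖ ^ 2 := fun a => by
    rw [← real_inner_self_eq_norm_sq, h, inner_self_eq_norm_sq]
  refine (sq_eq_sq₀ (norm_nonneg _) (norm_nonneg _)).mp ?_
  rw [norm_sub_sq_real, norm_sub_sq (𝕜 := ℂ), hn, hn, h, inner_re_symm]

theorem tendsto_fourierLp_iff (hα : 0 < α) {φ : ℝ → TD d} {k : ℝ → Rd d → ℂ}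
    (h : IsApproximable α T φ k) (φn : ℕ → 𝓓(strip d T, ℝ)) :
    Tendsto (fun n => normZeroSq α T (fun t => slices (fun s x => φn n (s, x)) t - φ t)) atTop (𝓝 0)
      ↔ Tendsto (fun n => fourierLp hα (φn n)) atTop (𝓝 (h.memLp.toLp _)) := by
  rw [tendsto_iff_edist_tendsto_0]
  simp only [fourierLp, Lp.edist_toLp_toLp]
  simp only [fun n => (fourierRep_testFunction (φn n)).normZeroSq_sub_eq (α := α) h.rep]
  constructor
  · intro ht
    have := (ENNReal.continuous_rpow_const (y := 1 / 2)).tendsto 0 |>.comp ht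
    simp only [ENNReal.zero_rpow_of_pos (by norm_num : (0 : ℝ) < 1 / 2)] at this
    refine this.congr fun n => ?_
    rw [Function.comp_apply, ← ENNReal.rpow_natCast, ← ENNReal.rpow_mul]
    norm_num
  · intro ht
    simpa [Function.comp_def] using ((ENNReal.continuous_pow 2).tendsto 0).comp ht

theorem tendsto_noiseLp_iff {f : Rd d → ℝ} (hF : IsGaussianNoise f T P F) {Y : Ω → ℝ}
    (hY : MemLp Y 2 P) (φn : ℕ → 𝓓(strip d T, ℝ)) :
    Tendsto (fun n => eLpNorm (fun ω => F (φn n) ω - Y ω) 2 P) atTop (𝓝 0) ↔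
      Tendsto (fun n => noiseLp hF (φn n)) atTop (𝓝 (hY.toLp _)) := by
  rw [tendsto_iff_edist_tendsto_0]
  simp only [noiseLp, Lp.edist_toLp_toLp]
  rfl

/-- Approximating test functions are Cauchy on the Fourier side. By the isometry their noise values
are Cauchy in `L²(Ω)`, which is complete. -/
theorem IsApproximable.exists_isStochInt (hα : 0 < α)
    (hF : IsGaussianNoise (besselKernel d α) T P F) {φ : ℝ → TD d} {k : ℝ → Rd d → ℂ}
    (h : IsApproximable α T φ k) : ∃ Y, IsStochInt α T P F φ Y := by
  have hex : ∀ n : ℕ, ∃ η : 𝓓(strip d T, ℝ), eLpNorm (wtd (-α / 2) (testFourier η) -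
      wtd (-α / 2) k) 2 (slab d T) < ENNReal.ofReal (1 / (n + 1)) := fun n =>
    h.approx _ (by rw [ENNReal.ofReal_pos]; positivity)
  choose φn hφn using hex
  have hlim : Tendsto (fun n => fourierLp hα (φn n)) atTop (𝓝 (h.memLp.toLp _)) := by
    rw [tendsto_iff_edist_tendsto_0]
    simp only [fourierLp, Lp.edist_toLp_toLp]
    have h0 : Tendsto (fun n : ℕ => ENNReal.ofReal (1 / ((n : ℝ) + 1))) atTop (𝓝 0) := by
      simpa using ENNReal.tendsto_ofReal (tendsto_one_div_add_atTop_nhds_zero_nat (𝕜 := ℝ))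
    exact tendsto_of_tendsto_of_tendsto_of_le_of_le tendsto_const_nhds h0 (fun _ => zero_le)
      fun n => (hφn n).le
  have hcau : CauchySeq fun n => noiseLp hF (φn n) := by
    have hc := hlim.cauchySeq
    rw [Metric.cauchySeq_iff] at hc ⊢
    simpa only [dist_eq_norm, norm_noiseLp_sub hα hF] using hc
  obtain ⟨y, hy⟩ := cauchySeq_tendsto_of_complete hcau
  refine ⟨y, Lp.memLp y, φn, (tendsto_fourierLp_iff hα h φn).mpr hlim, ?_⟩
  rw [tendsto_noiseLp_iff hF (Lp.memLp y), Lp.toLp_coeFn]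
  exact hy

theorem IsApproximable.isStochInt (hα : 0 < α)
    (hF : IsGaussianNoise (besselKernel d α) T P F) {φ : ℝ → TD d} {k : ℝ → Rd d → ℂ}
    (h : IsApproximable α T φ k) : IsStochInt α T P F φ (stochInt α T P F φ) := by
  have hex := h.exists_isStochInt hα hF
  rw [stochInt, dif_pos hex]
  exact hex.choose_spec

/-- The isometry property of the stochastic integral. -/
theorem integral_stochInt_mul (hα : 0 < α)
    (hF : IsGaussianNoise (besselKernel d α) T P F) {φ ψ : ℝ → TD d} {k l : ℝ → Rd d → ℂ}
    (h : IsApproximable α T φ k) (h' : IsApproximable α T ψ l) :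
    ((∫ ω, stochInt α T P F φ ω * stochInt α T P F ψ ω ∂P : ℝ) : ℂ) =
      ∫ p, inner ℂ (wtd (-α / 2) l p) (wtd (-α / 2) k p) ∂(slab d T) := by
  obtain ⟨hY, φn, hφ1, hφ2⟩ := h.isStochInt hα hF
  obtain ⟨hZ, ψn, hψ1, hψ2⟩ := h'.isStochInt hα hF
  rw [tendsto_fourierLp_iff hα h] at hφ1
  rw [tendsto_fourierLp_iff hα h'] at hψ1
  rw [tendsto_noiseLp_iff hF hY] at hφ2
  rw [tendsto_noiseLp_iff hF hZ] at hψ2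
  -- Both sides are limits of the same inner products along the sequences attached to the chosen
  -- versions, so the arbitrary choice made in `stochInt` is harmless.
  have h1 := (Complex.continuous_ofReal.tendsto _).comp (hφ2.inner (𝕜 := ℝ) hψ2)
  have h2 := hψ1.inner (𝕜 := ℂ) hφ1
  have h3 := tendsto_nhds_unique h1 (h2.congr fun n => (inner_noiseLp hα hF _ _).symm)
  rw [inner_toLp, inner_toLp] at h3
  rw [← h3]
  simp [mul_comm]

end noise

/-! ### The function `h` on the Fourier side -/

theorem wtd_congr {γ : ℝ} {k l : ℝ → Rd d → ℂ} {μ : Measure (ℝ × Rd d)}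
    (h : (fun p : ℝ × Rd d => k p.1 p.2) =ᵐ[μ] fun p => l p.1 p.2) : wtd γ k =ᵐ[μ] wtd γ l := by
  filter_upwards [h] with p hp
  simp only [wtd, hp]

/-- A genuinely measurable representative has measurable sections for every `ξ`, which the later
estimates at fixed `ξ` require. -/
theorem IsApproximable.exists_measurable {α T : ℝ} {φ : ℝ → TD d} {k : ℝ → Rd d → ℂ}
    (h : IsApproximable α T φ k) : ∃ l : ℝ → Rd d → ℂ,
      (Measurable fun p : ℝ × Rd d => l p.1 p.2) ∧ IsApproximable α T φ l := by
  have hm := h.rep.aemeasurable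
  let l : ℝ → Rd d → ℂ := fun t ξ => hm.mk _ (t, ξ)
  have hl : Measurable fun p : ℝ × Rd d => l p.1 p.2 := hm.measurable_mk
  have hkl : (fun p : ℝ × Rd d => k p.1 p.2) =ᵐ[slab d T] fun p => l p.1 p.2 := hm.ae_eq_mk
  have hw : wtd (-α / 2) k =ᵐ[slab d T] wtd (-α / 2) l := wtd_congr hkl
  refine ⟨l, hl, ⟨hl.aemeasurable, ?_⟩, h.memLp.ae_eq hw, fun ε hε => ?_⟩
  · filter_upwards [h.rep.density, Measure.ae_ae_of_ae_prod hkl] with t ht ht'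
    exact ht.congr ht'
  · obtain ⟨η, hη⟩ := h.approx ε hε
    refine ⟨η, ?_⟩
    rwa [← eLpNorm_congr_ae (EventuallyEq.rfl.sub hw)]

/-- The Fourier transform of the solution of the heat equation with inhomogeneity `K`, on `[0,T]`
and on the Fourier side. -/
def duhamel (T : ℝ) (K : ℝ → Rd d → ℂ) (t : ℝ) (ξ : Rd d) : ℂ :=
  ∫ s in Icc 0 T, (heatSymb (t - s) ξ : ℂ) * K s ξ

/-- The Fourier transform of `(1-Δ)^{-α/2} φ`. -/
def potential (α : ℝ) (k : ℝ → Rd d → ℂ) (t : ℝ) (ξ : Rd d) : ℂ :=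
  ((symb ξ ^ (-α / 2) : ℝ) : ℂ) * k t ξ

/-- Conjugation turns the Fourier character of the translated heat kernel into the kernel of the
inverse transform, and the two half weights combine to the symbol of `(1-Δ)^{-α/2}`. -/
theorem inner_wtd_heatSlice (α t : ℝ) (x : Rd d) (k : ℝ → Rd d → ℂ) (p : ℝ × Rd d) :
    inner ℂ (wtd (-α / 2) (sliceFourier (heatSlice t x)) p) (wtd (-α / 2) k p) =
      (Real.fourierChar (inner ℝ x p.2) : ℂ) *
        ((heatSymb (t - p.1) p.2 : ℂ) * potential α k p.1 p.2) := by
  have h1 : ((symb p.2 ^ (-α / 2) : ℝ) : ℂ) = ((symb p.2 ^ (-α / 2 / 2) : ℝ) : ℂ) *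
      ((symb p.2 ^ (-α / 2 / 2) : ℝ) : ℂ) := by
    rw [← Complex.ofReal_mul, ← Real.rpow_add (symb_pos _)]
    congr 2; ring
  have h2 : (starRingEnd ℂ) (Real.fourierChar (-(inner ℝ x p.2)) : ℂ) =
      (Real.fourierChar (inner ℝ x p.2) : ℂ) := by
    rw [← Circle.coe_inv_eq_conj, ← AddChar.map_neg_eq_inv, neg_neg]
  simp only [wtd, sliceFourier_heatSlice, potential, RCLike.inner_apply, map_mul,
    Complex.conj_ofReal, h1, h2]
  ring

/-- A product of two `L²` functions; the choice `x = 0` makes the character trivial. -/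
theorem integrable_heatSymb_mul_potential {α T t : ℝ} (hα : 0 < α) (hd : (d : ℝ) - 2 < α)
    (ht : t ≤ T) {φ : ℝ → TD d} {k : ℝ → Rd d → ℂ} (h : IsApproximable α T φ k) :
    Integrable (fun p : ℝ × Rd d => (heatSymb (t - p.1) p.2 : ℂ) * potential α k p.1 p.2)
      (slab d T) := by
  have h1 := h.memLp.integrable_mul (isApproximable_heatSlice hα hd ht (0 : Rd d)).memLp.star
  refine h1.congr (ae_of_all _ fun p => ?_)
  have := inner_wtd_heatSlice α t 0 k p
  simp only [inner_zero_left, AddChar.map_zero_eq_one, Circle.coe_one, one_mul] at this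
  exact this

theorem integrable_duhamel {α T t : ℝ} (hα : 0 < α) (hd : (d : ℝ) - 2 < α)
    (ht : t ≤ T) {φ : ℝ → TD d} {k : ℝ → Rd d → ℂ} (h : IsApproximable α T φ k) :
    Integrable (duhamel T (potential α k) t) :=
  (integrable_heatSymb_mul_potential hα hd ht h).integral_prod_right

/-- The isometry gives an integral over time and frequency. Carrying out the time integral first
leaves the Duhamel integral, because `heatSymb (t - s)` vanishes for `s ≥ t`. -/
theorem hFun_eq_fourierInv {α T t : ℝ} {Ω : Type*} [MeasurableSpace Ω] {P : Measure Ω}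
    {F : 𝓓(strip d T, ℝ) → Ω → ℝ} (hF : IsGaussianNoise (besselKernel d α) T P F) (hα : 0 < α)
    (hd : (d : ℝ) - 2 < α) (ht : t ≤ T) {φ : ℝ → TD d} {k : ℝ → Rd d → ℂ}
    (h : IsApproximable α T φ k) (x : Rd d) :
    (hFun α T P F φ t x : ℂ) = 𝓕⁻ (duhamel T (potential α k) t) x := by
  have hch : Continuous fun p : ℝ × Rd d => ((Real.fourierChar (inner ℝ x p.2) : Circle) : ℂ) :=
    continuous_subtype_val.comp (Real.continuous_fourierChar.comp (by fun_prop))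
  have hint : Integrable (fun p : ℝ × Rd d => (Real.fourierChar (inner ℝ x p.2) : ℂ) *
      ((heatSymb (t - p.1) p.2 : ℂ) * potential α k p.1 p.2)) (slab d T) :=
    (integrable_heatSymb_mul_potential hα hd ht h).bdd_mul (c := 1) hch.aestronglyMeasurable
      (ae_of_all _ fun p => (Circle.norm_coe _).le)
  have h1 := integral_stochInt_mul hα hF h (isApproximable_heatSlice hα hd ht x)
  simp only [inner_wtd_heatSlice] at h1
  rw [integral_prod_symm _ hint] at h1
  rw [Real.fourierInv_eq]
  refine h1.trans (integral_congr_ae (ae_of_all _ fun ξ => ?_))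
  simp only [duhamel, Circle.smul_def, smul_eq_mul]
  rw [integral_const_mul, real_inner_comm]

/-! ### Fourier multipliers -/

/-- Multiplication by `m` keeps test functions compactly supported, so local integrability of `g`
suffices. -/
theorem IsFourierDensity.smulLeft {S S' : TD d} {g m : Rd d → ℂ} (hg : IsFourierDensity S g)
    (hm : m.HasTemperateGrowth) (h : 𝓕 S' = TemperedDistribution.smulLeftCLM ℂ m (𝓕 S)) :
    IsFourierDensity S' fun ξ => m ξ * g ξ := by
  have hc : Continuous m := hm.1.continuous
  refine ⟨?_, fun ψ hψ => ?_⟩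
  · have := hg.1.continuous_smul hc
    exact this
  · have hcs : HasCompactSupport (SchwartzMap.smulLeftCLM ℂ m ψ) := by
      rw [SchwartzMap.smulLeftCLM_apply hm]
      exact hψ.mul_left
    rw [h, TemperedDistribution.smulLeftCLM_apply_apply, hg.2 _ hcs]
    refine integral_congr_ae (ae_of_all _ fun ξ => ?_)
    simp only [SchwartzMap.smulLeftCLM_apply_apply hm, smul_eq_mul]
    ring

theorem IsFourierDensity.smul {S : TD d} {g : Rd d → ℂ} (hg : IsFourierDensity S g) (c : ℂ) :
    IsFourierDensity (c • S) fun ξ => c * g ξ := by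
  refine hg.smulLeft (Function.HasTemperateGrowth.const c) ?_
  rw [TemperedDistribution.smulLeftCLM_const, FourierTransform.fourier_smul]

theorem IsFourierDensity.oneSubLaplacianPow {S : TD d} {g : Rd d → ℂ} (hg : IsFourierDensity S g)
    (s : ℝ) : IsFourierDensity (oneSubLaplacianPow s S)
      fun ξ => ((symb ξ ^ (s / 2) : ℝ) : ℂ) * g ξ := by
  refine hg.smulLeft (hasTemperateGrowth_symb_rpow_ofReal (s / 2)) ?_
  rw [BesselHeat.oneSubLaplacianPow, TemperedDistribution.fourierMultiplierCLM_apply,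
    FourierTransform.fourier_fourierInv_eq]
  rfl

theorem IsFourierDensity.lineDeriv {S : TD d} {g : Rd d → ℂ} (hg : IsFourierDensity S g)
    (m : Rd d) : IsFourierDensity (∂_{m} S)
      fun ξ => (2 * Real.pi * Complex.I) * (((inner ℝ ξ m : ℝ) : ℂ) * g ξ) := by
  have hm : (fun ξ : Rd d => ((inner ℝ ξ m : ℝ) : ℂ)).HasTemperateGrowth :=
    Function.Complex.hasTemperateGrowth_ofReal.comp (Function.hasTemperateGrowth_inner_left m)
  rw [TemperedDistribution.lineDeriv_eq_fourierMultiplierCLM]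
  refine IsFourierDensity.smul (hg.smulLeft hm ?_) _
  rw [TemperedDistribution.fourierMultiplierCLM_apply, FourierTransform.fourier_fourierInv_eq]

/-- The symbol of `-Δ`. -/
def lapSymb (ξ : Rd d) : ℝ := (2 * Real.pi) ^ 2 * ‖ξ‖ ^ 2

theorem lapSymb_nonneg (ξ : Rd d) : 0 ≤ lapSymb ξ := by unfold lapSymb; positivity

theorem lapSymb_le_symb (ξ : Rd d) : lapSymb ξ ≤ symb ξ := by unfold lapSymb symb; linarith

theorem continuous_lapSymb : Continuous (lapSymb : Rd d → ℝ) := by unfold lapSymb; fun_prop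

theorem IsFourierDensity.laplacian {S : TD d} {g : Rd d → ℂ} (hg : IsFourierDensity S g) :
    IsFourierDensity (Δ S) fun ξ => -(lapSymb ξ : ℂ) * g ξ := by
  have hm : (fun ξ : Rd d => ((‖ξ‖ ^ 2 : ℝ) : ℂ)).HasTemperateGrowth :=
    Function.Complex.hasTemperateGrowth_ofReal.comp (Function.hasTemperateGrowth_norm_sq _)
  rw [TemperedDistribution.laplacian_eq_fourierMultiplierCLM]
  have h1 := IsFourierDensity.smul (hg.smulLeft hm (S' := TemperedDistribution.fourierMultiplierCLM ℂ
    (fun ξ : Rd d => ((‖ξ‖ ^ 2 : ℝ) : ℂ)) S) (by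
      rw [TemperedDistribution.fourierMultiplierCLM_apply,
        FourierTransform.fourier_fourierInv_eq])) (-(((2 * Real.pi) ^ 2 : ℝ) : ℂ))
  have e : (-(2 * Real.pi) ^ 2 : ℝ) • TemperedDistribution.fourierMultiplierCLM ℂ
      (fun ξ : Rd d => ((‖ξ‖ ^ 2 : ℝ) : ℂ)) S = (-(((2 * Real.pi) ^ 2 : ℝ) : ℂ)) •
      TemperedDistribution.fourierMultiplierCLM ℂ (fun ξ : Rd d => ((‖ξ‖ ^ 2 : ℝ) : ℂ)) S := by
    ext ψ
    simp
  rw [e]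
  refine (congrArg (IsFourierDensity _) (funext fun ξ => ?_)).mp h1
  simp only [lapSymb]
  push_cast
  ring

theorem isDensity_fourierInv_apply {S : TD d} {g : Rd d → ℂ} (h : IsDensity (𝓕 S) g)
    (ψ : 𝓢(Rd d, ℂ)) : S ψ = ∫ ξ, (𝓕⁻ ψ : 𝓢(Rd d, ℂ)) ξ * g ξ := by
  rw [← (h _).2, TemperedDistribution.fourier_apply, FourierTransform.fourier_fourierInv_eq]

theorem weightedSq_const_mul_le {γ δ : ℝ} {g k : Rd d → ℂ}
    (h : ∀ ξ, ‖g ξ‖ ^ 2 * symb ξ ^ γ ≤ ‖k ξ‖ ^ 2 * symb ξ ^ δ) :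
    weightedSq γ g ≤ weightedSq δ k := by
  refine lintegral_mono fun ξ => ?_
  have e : ∀ (z : ℂ) (r : ℝ), ‖z‖ₑ ^ 2 * ENNReal.ofReal r = ENNReal.ofReal (‖z‖ ^ 2 * r) :=
    fun z r => by
      rw [ENNReal.ofReal_mul (by positivity), ENNReal.ofReal_pow (norm_nonneg _), ofReal_norm]
  rw [e, e]
  exact ENNReal.ofReal_le_ofReal (h ξ)

theorem weightedSq_lapSymb_mul_le (γ : ℝ) (g : Rd d → ℂ) :
    weightedSq γ (fun ξ => -(lapSymb ξ : ℂ) * g ξ) ≤ weightedSq (γ + 2) g := by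
  refine weightedSq_const_mul_le fun ξ => ?_
  rw [norm_mul, norm_neg, Complex.norm_real, Real.norm_of_nonneg (lapSymb_nonneg ξ), mul_pow,
    Real.rpow_add (symb_pos ξ), Real.rpow_two]
  have h1 := lapSymb_le_symb ξ
  have h2 := lapSymb_nonneg ξ
  have h3 : 0 < symb ξ ^ γ := Real.rpow_pos_of_pos (symb_pos ξ) _
  have h4 : lapSymb ξ ^ 2 ≤ symb ξ ^ 2 := by gcongr
  calc lapSymb ξ ^ 2 * ‖g ξ‖ ^ 2 * symb ξ ^ γ ≤ symb ξ ^ 2 * ‖g ξ‖ ^ 2 * symb ξ ^ γ := by gcongr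
    _ = _ := by ring

/-- By Cauchy–Schwarz `|⟪ξ, m⟫ ⟪ξ, n⟫| ≤ |ξ|²`, so the Laplacian bound covers all second
derivatives. -/
theorem weightedSq_lineDeriv_mul_le (γ : ℝ) (g : Rd d → ℂ) {m n : Rd d} (hm : ‖m‖ ≤ 1)
    (hn : ‖n‖ ≤ 1) :
    weightedSq γ (fun ξ => (2 * Real.pi * Complex.I) * (((inner ℝ ξ m : ℝ) : ℂ) *
      ((2 * Real.pi * Complex.I) * (((inner ℝ ξ n : ℝ) : ℂ) * g ξ)))) ≤
      weightedSq (γ + 2) g := by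
  refine (weightedSq_const_mul_le (k := fun ξ => -(lapSymb ξ : ℂ) * g ξ) fun ξ => ?_).trans
    (weightedSq_lapSymb_mul_le γ g)
  have h1 : ∀ m : Rd d, ‖m‖ ≤ 1 → |inner ℝ ξ m| ≤ ‖ξ‖ := fun m hm =>
    (abs_real_inner_le_norm ξ m).trans (mul_le_of_le_one_right (norm_nonneg _) hm)
  have h3 : 0 < symb ξ ^ γ := Real.rpow_pos_of_pos (symb_pos ξ) _
  refine mul_le_mul_of_nonneg_right ?_ h3.le
  refine pow_le_pow_left₀ (norm_nonneg _) ?_ 2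
  simp only [norm_mul, norm_neg, Complex.norm_real, Complex.norm_I, mul_one, Complex.norm_ofNat,
    Real.norm_eq_abs, abs_of_pos Real.pi_pos, abs_of_nonneg (lapSymb_nonneg ξ)]
  have h4 := mul_le_mul (h1 m hm) (h1 n hn) (abs_nonneg _) (norm_nonneg _)
  have h5 : 0 ≤ (2 * Real.pi) ^ 2 * ‖g ξ‖ := by positivity
  have h6 := mul_le_mul_of_nonneg_left h4 h5
  unfold lapSymb
  nlinarith

/-! ### Estimates for the Duhamel integral -/

/-- Cauchy–Schwarz for the pair `k`, `1` with respect to the measure of density `f`. Keeping `f` to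
the first power in both factors is what makes the Schur test work. -/
theorem sq_lintegral_mul_le {X : Type*} [MeasurableSpace X] {μ : Measure X} {f k : X → ℝ≥0∞}
    (hf : Measurable f) (hk : Measurable k) :
    (∫⁻ x, f x * k x ∂μ) ^ 2 ≤ (∫⁻ x, f x ∂μ) * ∫⁻ x, f x * k x ^ 2 ∂μ := by
  have h := ENNReal.lintegral_mul_le_Lp_mul_Lq (μ.withDensity f) Real.HolderConjugate.two_two
    hk.aemeasurable (aemeasurable_const (b := (1 : ℝ≥0∞)))
  simp only [Pi.mul_apply, mul_one, ENNReal.rpow_two] at h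
  rw [lintegral_withDensity_eq_lintegral_mul _ hf hk,
    lintegral_withDensity_eq_lintegral_mul _ hf (hk.pow_const 2),
    lintegral_withDensity_eq_lintegral_mul _ hf measurable_const] at h
  simp only [Pi.mul_apply] at h
  refine (pow_le_pow_left₀ zero_le h 2).trans (le_of_eq ?_)
  rw [mul_pow, ← ENNReal.rpow_natCast, ← ENNReal.rpow_natCast, ← ENNReal.rpow_mul,
    ← ENNReal.rpow_mul]
  norm_num
  rw [mul_comm]

theorem measurable_heatSymb_sub (t : ℝ) :
    Measurable fun p : ℝ × Rd d => heatSymb (t - p.1) p.2 :=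
  measurable_heatSymb.comp ((measurable_const.sub measurable_fst).prodMk measurable_snd)

theorem measurable_slice {k : ℝ → Rd d → ℂ} (hk : Measurable fun p : ℝ × Rd d => k p.1 p.2)
    (ξ : Rd d) : Measurable fun s => k s ξ :=
  hk.comp (measurable_id.prodMk measurable_const)

theorem measurable_duhamel {T : ℝ} {K : ℝ → Rd d → ℂ}
    (hK : Measurable fun p : ℝ × Rd d => K p.1 p.2) :
    Measurable fun p : ℝ × Rd d => duhamel T K p.1 p.2 := by
  have h1 : StronglyMeasurable fun q : (ℝ × Rd d) × ℝ =>
      (heatSymb (q.1.1 - q.2) q.1.2 : ℂ) * K q.2 q.1.2 := by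
    refine Measurable.stronglyMeasurable (Measurable.mul ?_ ?_)
    · exact Complex.measurable_ofReal.comp (measurable_heatSymb.comp
        (((measurable_fst.comp measurable_fst).sub measurable_snd).prodMk
          (measurable_snd.comp measurable_fst)))
    · exact hK.comp (measurable_snd.prodMk (measurable_snd.comp measurable_fst))
  exact (h1.integral_prod_right' (ν := volume.restrict (Icc 0 T))).measurable

theorem enorm_duhamel_sq_le {T t : ℝ} (ht : t ≤ T) {K : ℝ → Rd d → ℂ}
    (hK : Measurable fun p : ℝ × Rd d => K p.1 p.2) (ξ : Rd d) :
    ‖duhamel T K t ξ‖ₑ ^ 2 ≤ ENNReal.ofReal (Real.exp T) * ENNReal.ofReal (symb ξ)⁻¹ *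
      ∫⁻ s in Icc 0 T, ENNReal.ofReal (heatSymb (t - s) ξ) * ‖K s ξ‖ₑ ^ 2 := by
  have h1 : ‖duhamel T K t ξ‖ₑ ≤
      ∫⁻ s in Icc 0 T, ENNReal.ofReal (heatSymb (t - s) ξ) * ‖K s ξ‖ₑ := by
    refine (enorm_integral_le_lintegral_enorm _).trans (lintegral_mono fun s => le_of_eq ?_)
    rw [enorm_mul, ← ofReal_norm, Complex.norm_real, Real.norm_of_nonneg (heatSymb_nonneg _ _)]
  have hm : Measurable fun s => ENNReal.ofReal (heatSymb (t - s) ξ) :=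
    ((measurable_heatSymb_sub t).comp (measurable_id.prodMk measurable_const)).ennreal_ofReal
  refine (pow_le_pow_left₀ zero_le h1 2).trans
    ((sq_lintegral_mul_le hm (measurable_slice hK ξ).enorm).trans ?_)
  exact mul_le_mul_left (lintegral_heatSymb_sub_le ht ξ) _

theorem lintegral_weightedSq_eq {γ : ℝ} {μ : Measure ℝ} [SFinite μ] {k : ℝ → Rd d → ℂ}
    (hk : Measurable fun p : ℝ × Rd d => k p.1 p.2) :
    ∫⁻ t, weightedSq γ (k t) ∂μ =
      ∫⁻ ξ, (∫⁻ t, ‖k t ξ‖ₑ ^ 2 ∂μ) * ENNReal.ofReal (symb ξ ^ γ) := by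
  have hm : Measurable fun p : ℝ × Rd d => ‖k p.1 p.2‖ₑ ^ 2 * ENNReal.ofReal (symb p.2 ^ γ) :=
    (hk.enorm.pow_const 2).mul
      ((continuous_symb_rpow _).measurable.comp measurable_snd).ennreal_ofReal
  simp only [weightedSq]
  rw [lintegral_lintegral_swap hm.aemeasurable]
  refine lintegral_congr fun ξ => ?_
  rw [lintegral_mul_const' _ _ ENNReal.ofReal_ne_top]

/-- Schur test: one factor `C` is the mass of the kernel in `s`, the other its mass in `t` after
exchanging the integrals. -/
theorem lintegral_enorm_duhamel_sq_le {T : ℝ} {K : ℝ → Rd d → ℂ}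
    (hK : Measurable fun p : ℝ × Rd d => K p.1 p.2) (ξ : Rd d) :
    ∫⁻ t in Icc 0 T, ‖duhamel T K t ξ‖ₑ ^ 2 ≤
      (ENNReal.ofReal (Real.exp T) * ENNReal.ofReal (symb ξ)⁻¹) ^ 2 *
        ∫⁻ s in Icc 0 T, ‖K s ξ‖ₑ ^ 2 := by
  set C := ENNReal.ofReal (Real.exp T) * ENNReal.ofReal (symb ξ)⁻¹ with hC
  have hCt : C ≠ ∞ := ENNReal.mul_ne_top ENNReal.ofReal_ne_top ENNReal.ofReal_ne_top
  have hm : Measurable fun p : ℝ × ℝ =>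
      ENNReal.ofReal (heatSymb (p.1 - p.2) ξ) * ‖K p.2 ξ‖ₑ ^ 2 :=
    (measurable_heatSymb.comp ((measurable_fst.sub measurable_snd).prodMk
      measurable_const)).ennreal_ofReal.mul
      (((measurable_slice hK ξ).comp measurable_snd).enorm.pow_const 2)
  calc ∫⁻ t in Icc 0 T, ‖duhamel T K t ξ‖ₑ ^ 2
      ≤ ∫⁻ t in Icc 0 T, C * ∫⁻ s in Icc 0 T,
          ENNReal.ofReal (heatSymb (t - s) ξ) * ‖K s ξ‖ₑ ^ 2 :=
        setLIntegral_mono' measurableSet_Icc fun t ht => enorm_duhamel_sq_le ht.2 hK ξ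
    _ = C * ∫⁻ s in Icc 0 T, (∫⁻ t in Icc 0 T, ENNReal.ofReal (heatSymb (t - s) ξ)) *
          ‖K s ξ‖ₑ ^ 2 := by
        rw [lintegral_const_mul' _ _ hCt, lintegral_lintegral_swap hm.aemeasurable]
        congr 1
        refine lintegral_congr fun s => ?_
        rw [lintegral_mul_const' _ _ (by simp)]
    _ ≤ C * ∫⁻ s in Icc 0 T, C * ‖K s ξ‖ₑ ^ 2 := by
        refine mul_le_mul_right (setLIntegral_mono' measurableSet_Icc fun s hs => ?_) _
        exact mul_le_mul_left (lintegral_heatSymb_sub_le' hs.1 ξ) _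
    _ = _ := by rw [lintegral_const_mul' _ _ hCt, ← mul_assoc, sq]

theorem ofReal_symb_rpow_add (γ δ : ℝ) (ξ : Rd d) : ENNReal.ofReal (symb ξ ^ (γ + δ)) =
    ENNReal.ofReal (symb ξ ^ γ) * ENNReal.ofReal (symb ξ ^ δ) := by
  rw [Real.rpow_add (symb_pos ξ), ENNReal.ofReal_mul (Real.rpow_nonneg (symb_pos ξ).le _)]

/-- The Duhamel integral gains two derivatives in `L²`. -/
theorem lintegral_weightedSq_duhamel_le (γ : ℝ) {T : ℝ} {K : ℝ → Rd d → ℂ}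
    (hK : Measurable fun p : ℝ × Rd d => K p.1 p.2) :
    ∫⁻ t in Icc 0 T, weightedSq (γ + 2) (duhamel T K t) ≤
      ENNReal.ofReal (Real.exp T) ^ 2 * ∫⁻ t in Icc 0 T, weightedSq γ (K t) := by
  rw [lintegral_weightedSq_eq (measurable_duhamel hK), lintegral_weightedSq_eq hK,
    ← lintegral_const_mul' _ _ (by simp)]
  refine lintegral_mono fun ξ => ?_
  refine (mul_le_mul_left (lintegral_enorm_duhamel_sq_le hK ξ) _).trans (le_of_eq ?_)
  have h : ENNReal.ofReal (symb ξ)⁻¹ ^ 2 * ENNReal.ofReal (symb ξ ^ (2 : ℝ)) = 1 := by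
    rw [Real.rpow_two, ← ENNReal.ofReal_pow (inv_nonneg.mpr (symb_pos ξ).le),
      ← ENNReal.ofReal_mul (by positivity), ← mul_pow, inv_mul_cancel₀ (symb_pos ξ).ne']
    simp
  rw [ofReal_symb_rpow_add, mul_pow]
  calc _ = (ENNReal.ofReal (symb ξ)⁻¹ ^ 2 * ENNReal.ofReal (symb ξ ^ (2 : ℝ))) *
        (ENNReal.ofReal (Real.exp T) ^ 2 *
          ((∫⁻ s in Icc 0 T, ‖K s ξ‖ₑ ^ 2) * ENNReal.ofReal (symb ξ ^ γ))) := by ring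
    _ = _ := by rw [h, one_mul]

/-- The Duhamel integral gains one derivative at every time. -/
theorem weightedSq_duhamel_le (γ : ℝ) {T t : ℝ} (ht : t ≤ T) {K : ℝ → Rd d → ℂ}
    (hK : Measurable fun p : ℝ × Rd d => K p.1 p.2) :
    weightedSq (γ + 1) (duhamel T K t) ≤
      ENNReal.ofReal (Real.exp T) * ∫⁻ s in Icc 0 T, weightedSq γ (K s) := by
  rw [lintegral_weightedSq_eq hK, ← lintegral_const_mul' _ _ ENNReal.ofReal_ne_top]
  refine lintegral_mono fun ξ => ?_
  have h1 : ∫⁻ s in Icc 0 T, ENNReal.ofReal (heatSymb (t - s) ξ) * ‖K s ξ‖ₑ ^ 2 ≤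
      ∫⁻ s in Icc 0 T, ‖K s ξ‖ₑ ^ 2 := lintegral_mono fun s =>
    mul_le_of_le_one_left' (ENNReal.ofReal_le_one.mpr (heatSymb_le_one _ _))
  have h : ENNReal.ofReal (symb ξ)⁻¹ * ENNReal.ofReal (symb ξ ^ (1 : ℝ)) = 1 := by
    rw [Real.rpow_one, ← ENNReal.ofReal_mul (inv_nonneg.mpr (symb_pos ξ).le),
      inv_mul_cancel₀ (symb_pos ξ).ne']
    simp
  refine (mul_le_mul_left ((enorm_duhamel_sq_le ht hK ξ).trans (mul_le_mul_right h1 _)) _).trans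
    (le_of_eq ?_)
  rw [ofReal_symb_rpow_add]
  calc _ = (ENNReal.ofReal (symb ξ)⁻¹ * ENNReal.ofReal (symb ξ ^ (1 : ℝ))) *
        (ENNReal.ofReal (Real.exp T) *
          ((∫⁻ s in Icc 0 T, ‖K s ξ‖ₑ ^ 2) * ENNReal.ofReal (symb ξ ^ γ))) := by ring
    _ = _ := by rw [h, one_mul]

theorem ae_lintegral_sq_lt_top {γ : ℝ} {μ : Measure ℝ} [SFinite μ] {k : ℝ → Rd d → ℂ}
    (hk : Measurable fun p : ℝ × Rd d => k p.1 p.2) (h : ∫⁻ t, weightedSq γ (k t) ∂μ < ∞) :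
    ∀ᵐ ξ, ∫⁻ t, ‖k t ξ‖ₑ ^ 2 ∂μ < ∞ := by
  rw [lintegral_weightedSq_eq hk] at h
  have hm : Measurable fun ξ : Rd d => (∫⁻ t, ‖k t ξ‖ₑ ^ 2 ∂μ) * ENNReal.ofReal (symb ξ ^ γ) :=
    ((hk.enorm.pow_const 2).lintegral_prod_left').mul
      (continuous_symb_rpow _).measurable.ennreal_ofReal
  filter_upwards [ae_lt_top hm h.ne] with ξ hξ
  by_contra hne
  rw [not_lt_top_iff.mp hne, ENNReal.top_mul] at hξ
  · exact lt_irrefl _ hξ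
  · rw [Ne, ENNReal.ofReal_eq_zero, not_le]
    exact Real.rpow_pos_of_pos (symb_pos ξ) _

theorem ae_integrable_slice {γ : ℝ} {μ : Measure ℝ} [IsFiniteMeasure μ] {k : ℝ → Rd d → ℂ}
    (hk : Measurable fun p : ℝ × Rd d => k p.1 p.2) (h : ∫⁻ t, weightedSq γ (k t) ∂μ < ∞) :
    ∀ᵐ ξ, Integrable (fun t => k t ξ) μ := by
  filter_upwards [ae_lintegral_sq_lt_top hk h] with ξ hξ
  exact ((memLp_two_iff (measurable_slice hk ξ).aestronglyMeasurable).mpr hξ).integrable one_le_two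

/-- The weight is split off: `χ * symb ^ (-γ/2)` is Schwartz, hence in `L²` over the finite time
measure, and `wtd γ k` is in `L²`. This licenses the Fubini exchanges against test functions. -/
theorem integrable_schwartz_mul_prod {γ : ℝ} {μ : Measure ℝ} [IsFiniteMeasure μ]
    {k : ℝ → Rd d → ℂ} (hk : Measurable fun p : ℝ × Rd d => k p.1 p.2)
    (h : ∫⁻ t, weightedSq γ (k t) ∂μ < ∞) (χ : 𝓢(Rd d, ℂ)) :
    Integrable (fun p : ℝ × Rd d => χ p.2 * k p.1 p.2) (μ.prod volume) := by
  have h1 : MemLp (wtd γ k) 2 (μ.prod volume) := by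
    refine ⟨(aemeasurable_wtd hk.aemeasurable).aestronglyMeasurable, ?_⟩
    rw [← sq_eLpNorm_wtd hk.aemeasurable] at h
    simpa using h
  have htg := hasTemperateGrowth_symb_rpow_ofReal (d := d) (-(γ / 2))
  have h2 : MemLp (fun p : ℝ × Rd d => SchwartzMap.smulLeftCLM ℂ
      (fun ξ => ((symb ξ ^ (-(γ / 2)) : ℝ) : ℂ)) χ p.2) 2 (μ.prod volume) :=
    (SchwartzMap.memLp (SchwartzMap.smulLeftCLM ℂ
      (fun ξ : Rd d => ((symb ξ ^ (-(γ / 2)) : ℝ) : ℂ)) χ) 2 volume).comp_snd μ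
  refine (h2.integrable_mul h1).congr (ae_of_all _ fun p => ?_)
  change SchwartzMap.smulLeftCLM ℂ _ χ p.2 * wtd γ k p = _
  rw [SchwartzMap.smulLeftCLM_apply_apply htg, smul_eq_mul, wtd]
  calc _ = (((symb p.2 ^ (-(γ / 2)) : ℝ) : ℂ) * ((symb p.2 ^ (γ / 2) : ℝ) : ℂ)) *
        (χ p.2 * k p.1 p.2) := by ring
    _ = _ := by rw [symb_rpow_neg_mul_cancel, one_mul]

/-! ### The heat equation on the Fourier side -/

/-- On `(r,t)` the integrand is the derivative of `-exp(-lapSymb ξ * (s - r))`. Before time `r` it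
is zero, so for `r ≥ t` both sides vanish. -/
theorem integral_lapSymb_mul_heatSymb_sub {r t : ℝ} (hr : 0 ≤ r) (ξ : Rd d) :
    ∫ s in Ioo 0 t, lapSymb ξ * heatSymb (s - r) ξ =
      (Iio t).indicator 1 r - heatSymb (t - r) ξ := by
  rcases le_or_gt t r with h | h
  · have h1 : ∀ s ∈ Ioo 0 t, lapSymb ξ * heatSymb (s - r) ξ = 0 := fun s hs => by
      rw [heatSymb, if_neg (by linarith [hs.2]), mul_zero]
    rw [setIntegral_congr_fun measurableSet_Ioo h1, heatSymb, if_neg (by linarith)]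
    simp [h]
  · have h1 : ∀ s, lapSymb ξ * heatSymb (s - r) ξ =
        (Ioi r).indicator (fun s => lapSymb ξ * Real.exp (-lapSymb ξ * (s - r))) s := fun s => by
      by_cases hs : r < s
      · rw [indicator_of_mem (mem_Ioi.mpr hs), heatSymb, if_pos (sub_pos.mpr hs), lapSymb]
      · rw [indicator_of_notMem (notMem_Ioi.mpr (not_lt.mp hs)), heatSymb,
          if_neg (by simpa using hs), mul_zero]
    have h2 : Ioo 0 t ∩ Ioi r = Ioo r t := by
      ext s; simp only [mem_inter_iff, mem_Ioo, mem_Ioi]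
      constructor
      · rintro ⟨⟨-, h2⟩, h3⟩; exact ⟨h3, h2⟩
      · rintro ⟨h3, h2⟩; exact ⟨⟨hr.trans_lt h3, h2⟩, h3⟩
    simp only [h1]
    rw [setIntegral_indicator measurableSet_Ioi, h2, ← integral_Ioc_eq_integral_Ioo,
      ← intervalIntegral.integral_of_le h.le]
    have hd : ∀ s ∈ uIcc r t, HasDerivAt (fun s => -Real.exp (-lapSymb ξ * (s - r)))
        (lapSymb ξ * Real.exp (-lapSymb ξ * (s - r))) s := fun s _ => by
      have := ((((hasDerivAt_id s).sub_const r).const_mul (-lapSymb ξ)).exp).neg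
      refine this.congr_deriv ?_
      simp only [id]; ring
    rw [intervalIntegral.integral_eq_sub_of_hasDerivAt hd
      ((by fun_prop : Continuous _).intervalIntegrable _ _), heatSymb, if_pos (sub_pos.mpr h),
      indicator_of_mem (mem_Iio.mpr h), lapSymb]
    simp
    ring

theorem integrable_heatSymb_sub_mul {T : ℝ} {K : ℝ → Rd d → ℂ} {ξ : Rd d}
    (h : IntegrableOn (fun s => K s ξ) (Icc 0 T)) (t : ℝ) :
    IntegrableOn (fun s => (heatSymb (t - s) ξ : ℂ) * K s ξ) (Icc 0 T) := by
  refine h.bdd_mul (c := 1) ?_ (ae_of_all _ fun s => ?_)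
  · exact (Complex.measurable_ofReal.comp ((measurable_heatSymb_sub t).comp
      (measurable_id.prodMk measurable_const))).aestronglyMeasurable
  · rw [Complex.norm_real, Real.norm_of_nonneg (heatSymb_nonneg _ _)]
    exact heatSymb_le_one _ _

/-- The Duhamel integral solves the heat equation on the Fourier side. -/
theorem duhamel_eq {T t : ℝ} (ht : t ≤ T) {K : ℝ → Rd d → ℂ} {ξ : Rd d}
    (h : IntegrableOn (fun s => K s ξ) (Icc 0 T)) :
    duhamel T K t ξ = (∫ s in Ioo 0 t, -(lapSymb ξ : ℂ) * duhamel T K s ξ) +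
      ∫ s in Ioo 0 t, K s ξ := by
  have hK1 : Integrable (fun p : ℝ × ℝ => (lapSymb ξ * heatSymb (p.1 - p.2) ξ : ℂ) * K p.2 ξ)
      ((volume.restrict (Ioo 0 t)).prod (volume.restrict (Icc 0 T))) := by
    refine (h.comp_snd _).bdd_mul (c := lapSymb ξ) ?_ (ae_of_all _ fun p => ?_)
    · refine (Measurable.const_mul (Complex.measurable_ofReal.comp (measurable_heatSymb.comp
        ((measurable_fst.sub measurable_snd).prodMk measurable_const))) _).aestronglyMeasurable
    · rw [norm_mul, Complex.norm_real, Complex.norm_real,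
        Real.norm_of_nonneg (heatSymb_nonneg _ _), Real.norm_of_nonneg (lapSymb_nonneg _)]
      exact mul_le_of_le_one_right (lapSymb_nonneg _) (heatSymb_le_one _ _)
  -- After Fubini the inner integral is `1_{r<t} - heatSymb (t - r)`: the first term yields the
  -- integral of `K`, the second the Duhamel integral at time `t`.
  have h1 : ∫ s in Ioo 0 t, (lapSymb ξ : ℂ) * duhamel T K s ξ =
      ∫ r in Icc 0 T, ((Iio t).indicator (fun r => K r ξ) r - (heatSymb (t - r) ξ : ℂ) * K r ξ) := by
    calc ∫ s in Ioo 0 t, (lapSymb ξ : ℂ) * duhamel T K s ξ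
        = ∫ s in Ioo 0 t, ∫ r in Icc 0 T, (lapSymb ξ * heatSymb (s - r) ξ : ℂ) * K r ξ := by
          simp only [duhamel, ← integral_const_mul, mul_assoc]
      _ = ∫ r in Icc 0 T, ∫ s in Ioo 0 t, (lapSymb ξ * heatSymb (s - r) ξ : ℂ) * K r ξ :=
          integral_integral_swap hK1
      _ = _ := by
          refine setIntegral_congr_fun measurableSet_Icc fun r hr => ?_
          simp only [← Complex.ofReal_mul]
          rw [integral_mul_const, integral_complex_ofReal,
            integral_lapSymb_mul_heatSymb_sub hr.1, Complex.ofReal_sub, sub_mul]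
          congr 1
          by_cases hrt : r < t
          · simp [hrt]
          · simp [hrt]
  have h2 : ∫ r in Icc 0 T, (Iio t).indicator (fun r => K r ξ) r = ∫ s in Ioo 0 t, K s ξ := by
    rw [setIntegral_indicator measurableSet_Iio, ← integral_Ico_eq_integral_Ioo]
    congr 2
    ext s; simp only [mem_inter_iff, mem_Icc, mem_Iio, mem_Ico]
    exact ⟨fun hs => ⟨hs.1.1, hs.2⟩, fun hs => ⟨⟨hs.1, hs.2.le.trans ht⟩, hs.2⟩⟩
  rw [integral_sub (h.indicator measurableSet_Iio) (integrable_heatSymb_sub_mul h t), h2] at h1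
  simp only [neg_mul, integral_neg, h1]
  rw [duhamel]
  ring

/-! ### Solving the heat equation -/

theorem integral_schwartz_mul_integral {γ : ℝ} {μ : Measure ℝ} [IsFiniteMeasure μ]
    {k : ℝ → Rd d → ℂ} (hk : Measurable fun p : ℝ × Rd d => k p.1 p.2)
    (h : ∫⁻ t, weightedSq γ (k t) ∂μ < ∞) (χ : 𝓢(Rd d, ℂ)) :
    ∫ ξ, χ ξ * ∫ t, k t ξ ∂μ = ∫ t, (∫ ξ, χ ξ * k t ξ) ∂μ := by
  rw [integral_integral_swap (integrable_schwartz_mul_prod hk h χ)]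
  simp only [integral_const_mul]

theorem integrable_schwartz_mul_integral {γ : ℝ} {μ : Measure ℝ} [IsFiniteMeasure μ]
    {k : ℝ → Rd d → ℂ} (hk : Measurable fun p : ℝ × Rd d => k p.1 p.2)
    (h : ∫⁻ t, weightedSq γ (k t) ∂μ < ∞) (χ : 𝓢(Rd d, ℂ)) :
    Integrable fun ξ => χ ξ * ∫ t, k t ξ ∂μ := by
  have := (integrable_schwartz_mul_prod hk h χ).integral_prod_right
  simpa only [integral_const_mul] using this

theorem restrict_Ioo_eq_Icc (a b : ℝ) :
    (volume : Measure ℝ).restrict (Ioo a b) = volume.restrict (Icc a b) :=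
  Measure.restrict_congr_set Ioo_ae_eq_Icc

theorem memL2Sobolev_of_isFourierDensity {γ T : ℝ} {g : ℝ → TD d} {k : ℝ → Rd d → ℂ}
    (hk : Measurable fun p : ℝ × Rd d => k p.1 p.2)
    (hg : ∀ᵐ t ∂(volume.restrict (Ioo 0 T)), IsFourierDensity (g t) (k t))
    (h : ∫⁻ t in Ioo 0 T, weightedSq γ (k t) < ∞) : MemL2Sobolev γ T g := by
  refine ⟨⟨k, hk.aemeasurable, hg⟩, ?_⟩
  rwa [lintegral_congr_ae (hg.mono fun t ht => sobolevSq_eq ht)]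

theorem measurable_weightedSq {γ : ℝ} {k : ℝ → Rd d → ℂ}
    (hk : Measurable fun p : ℝ × Rd d => k p.1 p.2) : Measurable fun t => weightedSq γ (k t) :=
  Measurable.lintegral_prod_right' (f := fun p : ℝ × Rd d =>
    ‖k p.1 p.2‖ₑ ^ 2 * ENNReal.ofReal (symb p.2 ^ γ))
    ((hk.enorm.pow_const 2).mul
      ((continuous_symb_rpow _).measurable.comp measurable_snd).ennreal_ofReal)

theorem weightedSq_add_one_duhamel_lt_top {γ T t : ℝ} (ht : t ≤ T) {K : ℝ → Rd d → ℂ}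
    (hK : Measurable fun p : ℝ × Rd d => K p.1 p.2)
    (hfin : ∫⁻ t in Icc 0 T, weightedSq γ (K t) < ∞) :
    weightedSq (γ + 1) (duhamel T K t) < ∞ :=
  (weightedSq_duhamel_le γ ht hK).trans_lt (ENNReal.mul_lt_top ENNReal.ofReal_lt_top hfin)

theorem lintegral_weightedSq_duhamel_lt_top {γ T : ℝ} {K : ℝ → Rd d → ℂ}
    (hK : Measurable fun p : ℝ × Rd d => K p.1 p.2)
    (hfin : ∫⁻ t in Icc 0 T, weightedSq γ (K t) < ∞) :
    ∫⁻ t in Icc 0 T, weightedSq (γ + 2) (duhamel T K t) < ∞ :=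
  (lintegral_weightedSq_duhamel_le γ hK).trans_lt
    (ENNReal.mul_lt_top (ENNReal.pow_lt_top ENNReal.ofReal_lt_top) hfin)

theorem measurable_lapSymb_mul {k : ℝ → Rd d → ℂ}
    (hk : Measurable fun p : ℝ × Rd d => k p.1 p.2) :
    Measurable fun p : ℝ × Rd d => -(lapSymb p.2 : ℂ) * k p.1 p.2 :=
  ((Complex.measurable_ofReal.comp (continuous_lapSymb.measurable.comp measurable_snd)).neg).mul hk

/-- Every pairing with `ψ` becomes an integral against `χ = 𝓕⁻ ψ` on the Fourier side. Fubini then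
reduces the equation to `duhamel_eq` at almost every `ξ`. -/
theorem isSolution_of_duhamel {γ T : ℝ} {K : ℝ → Rd d → ℂ}
    (hK : Measurable fun p : ℝ × Rd d => K p.1 p.2)
    (hfin : ∫⁻ t in Icc 0 T, weightedSq γ (K t) < ∞) {v g : ℝ → TD d} (hT : 0 ≤ T)
    (hv : ∀ t ∈ Icc 0 T, IsFourierDensity (v t) (duhamel T K t))
    (hg : ∀ᵐ t ∂(volume.restrict (Icc 0 T)), IsFourierDensity (g t) (K t)) :
    IsSolution T v g := by
  have hfin1 : ∀ t ∈ Icc 0 T, weightedSq (γ + 1) (duhamel T K t) < ∞ := fun t ht =>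
    weightedSq_add_one_duhamel_lt_top ht.2 hK hfin
  refine ⟨⟨γ + 1, fun t ht => ?_⟩, ?_, fun t ht ψ hψ => ?_⟩
  · change sobolevSq _ _ < ∞
    rw [sobolevSq_eq (hv t ht)]
    exact hfin1 t ht
  · have h0 : duhamel T K 0 = 0 := by
      ext ξ
      have : ∀ s ∈ Icc 0 T, (heatSymb (0 - s) ξ : ℂ) * K s ξ = 0 := fun s hs => by
        rw [heatSymb, if_neg (by linarith [hs.1])]; simp
      rw [duhamel, setIntegral_congr_fun measurableSet_Icc this]
      simp
    refine ext_of_hasCompactSupport fun ψ _ => ?_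
    have h1 := hv 0 ⟨le_rfl, hT⟩
    rw [isDensity_fourierInv_apply (h1.isDensity (hfin1 0 ⟨le_rfl, hT⟩)), h0]
    simp
  · set χ : 𝓢(Rd d, ℂ) := 𝓕⁻ ψ with hχ
    set L : ℝ → Rd d → ℂ := fun s ξ => -(lapSymb ξ : ℂ) * duhamel T K s ξ with hL
    have hsub : Ioo 0 t ⊆ Icc 0 T := fun s hs => ⟨hs.1.le, hs.2.le.trans ht.2.le⟩
    have hLm : Measurable fun p : ℝ × Rd d => L p.1 p.2 :=
      measurable_lapSymb_mul (measurable_duhamel hK)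
    have hLfin : ∫⁻ s in Ioo 0 t, weightedSq γ (L s) < ∞ :=
      (lintegral_mono_set hsub).trans_lt ((lintegral_mono fun s =>
        weightedSq_lapSymb_mul_le γ _).trans_lt (lintegral_weightedSq_duhamel_lt_top hK hfin))
    have hKfin : ∫⁻ s in Ioo 0 t, weightedSq γ (K s) < ∞ :=
      (lintegral_mono_set hsub).trans_lt hfin
    have hvΔ : ∀ s ∈ Ioo 0 t, ∫ ξ, χ ξ * L s ξ = v s (Δ ψ) := fun s hs => by
      -- The bound of order `γ + 1` on the Duhamel integral holds at every time, whereas the one of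
      -- order `γ + 2` is only square integrable in time; the Laplacian is thus of order `γ - 1` for
      -- each `s`.
      have h1 : weightedSq (γ - 1) (L s) < ∞ :=
        (weightedSq_lapSymb_mul_le _ _).trans_lt (by
          have := hfin1 s (hsub hs)
          rwa [show γ - 1 + 2 = γ + 1 by ring])
      rw [← TemperedDistribution.laplacian_apply_apply,
        isDensity_fourierInv_apply ((hv s (hsub hs)).laplacian.isDensity h1)]
    have hgψ : ∀ᵐ s ∂(volume.restrict (Ioo 0 t)), ∫ ξ, χ ξ * K s ξ = g s ψ := by
      filter_upwards [ae_restrict_of_ae_restrict_of_subset hsub hg,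
        ae_lt_top (measurable_weightedSq hK) hKfin.ne] with s hs hs'
      rw [isDensity_fourierInv_apply (hs.isDensity hs')]
    have hvΔ' : (fun s => ∫ ξ, χ ξ * L s ξ) =ᵐ[volume.restrict (Ioo 0 t)] fun s => v s (Δ ψ) :=
      (ae_restrict_iff' measurableSet_Ioo).mpr (ae_of_all _ hvΔ)
    have hLi := integrable_schwartz_mul_prod hLm hLfin χ
    have hKi := integrable_schwartz_mul_prod hK hKfin χ
    refine ⟨hLi.integral_prod_left.congr hvΔ', hKi.integral_prod_left.congr hgψ, ?_⟩
    have htI : t ∈ Icc 0 T := Ioo_subset_Icc_self ht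
    rw [← integral_congr_ae hvΔ', ← integral_congr_ae hgψ,
      ← integral_schwartz_mul_integral hLm hLfin, ← integral_schwartz_mul_integral hK hKfin,
      isDensity_fourierInv_apply ((hv t htI).isDensity (hfin1 t htI)), ← integral_add]
    · refine integral_congr_ae ?_
      filter_upwards [ae_integrable_slice hK hfin] with ξ hξ
      rw [duhamel_eq ht.2.le hξ, mul_add]
    · exact integrable_schwartz_mul_integral hLm hLfin χ
    · exact integrable_schwartz_mul_integral hK hKfin χ

theorem mem_krylovSpace_of_duhamel {γ T : ℝ} {K : ℝ → Rd d → ℂ}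
    (hK : Measurable fun p : ℝ × Rd d => K p.1 p.2)
    (hfin : ∫⁻ t in Icc 0 T, weightedSq γ (K t) < ∞) {v g : ℝ → TD d} (hT : 0 ≤ T)
    (hv : ∀ t ∈ Icc 0 T, IsFourierDensity (v t) (duhamel T K t))
    (hg : ∀ᵐ t ∂(volume.restrict (Icc 0 T)), IsFourierDensity (g t) (K t)) :
    v ∈ KrylovSpace d (γ + 2) T := by
  have hv' : ∀ᵐ t ∂(volume.restrict (Icc 0 T)), IsFourierDensity (v t) (duhamel T K t) :=
    (ae_restrict_iff' measurableSet_Icc).mpr (ae_of_all _ hv)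
  have h2 := lintegral_weightedSq_duhamel_lt_top hK hfin
  have hDm := measurable_duhamel (T := T) hK
  have hi : ∀ m : Rd d, Measurable fun p : ℝ × Rd d => ((inner ℝ p.2 m : ℝ) : ℂ) := fun m => by
    fun_prop
  rw [KrylovSpace, add_sub_cancel_right]
  refine ⟨?_, fun i j => ?_, g, ?_, isSolution_of_duhamel hK hfin hT hv hg⟩
  · rw [restrict_Ioo_eq_Icc]
    filter_upwards [hv', ae_lt_top (measurable_weightedSq hDm) h2.ne] with t ht ht'
    change sobolevSq _ _ < ∞
    rwa [sobolevSq_eq ht]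
  · refine memL2Sobolev_of_isFourierDensity
      (k := fun t ξ => (2 * Real.pi * Complex.I) *
        (((inner ℝ ξ (EuclideanSpace.single i (1 : ℝ)) : ℝ) : ℂ) * ((2 * Real.pi * Complex.I) *
        (((inner ℝ ξ (EuclideanSpace.single j (1 : ℝ)) : ℝ) : ℂ) * duhamel T K t ξ)))) ?_ ?_ ?_
    · exact ((hi _).mul (((hi _).mul hDm).const_mul _)).const_mul _
    · rw [restrict_Ioo_eq_Icc]
      filter_upwards [hv'] with t ht
      exact (ht.lineDeriv _).lineDeriv _
    · rw [restrict_Ioo_eq_Icc]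
      refine (lintegral_mono fun t => weightedSq_lineDeriv_mul_le γ _ ?_ ?_).trans_lt h2 <;> simp
  · rw [← restrict_Ioo_eq_Icc] at hfin hg
    exact memL2Sobolev_of_isFourierDensity hK hg hfin

/-! ### Uniqueness for the heat equation -/

/-- Gronwall for the primitive of `f`, which satisfies `W' = -a W` in integrated form with `W 0 =
0`. -/
theorem eq_zero_of_ae_eq_mul_primitive {T a : ℝ} {f : ℝ → ℂ} (hf : IntegrableOn f (Ioo 0 T))
    (h : ∀ᵐ t ∂(volume.restrict (Ioo 0 T)), f t = -(a : ℂ) * ∫ s in Ioo 0 t, f s) :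
    ∀ t ∈ Ioo 0 T, ∫ s in Ioo 0 t, f s = 0 := by
  set F : ℝ → ℂ := (Ioo 0 T).indicator f with hF
  have hFi : Integrable F := hf.integrable_indicator measurableSet_Ioo
  set W : ℝ → ℂ := fun t => ∫ s in (0 : ℝ)..t, F s with hW
  have hWc : Continuous W := hFi.continuous_primitive 0
  have hWf : ∀ t ∈ Icc 0 T, W t = ∫ s in Ioo 0 t, f s := fun t ht => by
    simp only [hW, intervalIntegral.integral_of_le ht.1, integral_Ioc_eq_integral_Ioo]
    refine setIntegral_congr_fun measurableSet_Ioo fun s hs => ?_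
    have hs' : s ∈ Ioo 0 T := ⟨hs.1, hs.2.trans_le ht.2⟩
    exact indicator_of_mem hs' f
  -- As `f` is only integrable, `W` is merely known to be continuous. Its equation exhibits it on
  -- `[0,T]` as the primitive of a continuous function, so `V` is differentiable everywhere.
  set V : ℝ → ℂ := fun t => ∫ s in (0 : ℝ)..t, -(a : ℂ) * W s with hV
  have hVW : ∀ t ∈ Icc 0 T, V t = W t := fun t ht => by
    rw [hWf t ht]
    simp only [hV, intervalIntegral.integral_of_le ht.1, integral_Ioc_eq_integral_Ioo]
    have hsub : Ioo 0 t ⊆ Ioo 0 T := Ioo_subset_Ioo_right ht.2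
    refine integral_congr_ae ?_
    filter_upwards [ae_restrict_of_ae_restrict_of_subset hsub h,
      ae_restrict_mem measurableSet_Ioo] with s hs hs'
    rw [hs, hWf s ⟨hs'.1.le, hs'.2.le.trans ht.2⟩]
  have hVd : ∀ t, HasDerivAt V (-(a : ℂ) * W t) t := fun t =>
    intervalIntegral.integral_hasDerivAt_right ((by fun_prop : Continuous _).intervalIntegrable _ _)
      ((by fun_prop : Continuous fun s => -(a : ℂ) * W s).stronglyMeasurableAtFilter _ _)
      (by fun_prop : Continuous fun s => -(a : ℂ) * W s).continuousAt
  have hz := eq_zero_of_abs_deriv_le_mul_abs_self_of_eq_zero_right (f := V) (K := |a|) (a := 0)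
    (b := T) (fun t _ => (hVd t).continuousAt.continuousWithinAt)
    (fun t _ => (hVd t).hasDerivWithinAt) (by simp [hV]) (fun t ht => by
      rw [hVW t ⟨ht.1, ht.2.le⟩, norm_mul, norm_neg, Complex.norm_real, Real.norm_eq_abs])
  intro t ht
  rw [← hWf t ⟨ht.1.le, ht.2.le⟩, ← hVW t ⟨ht.1.le, ht.2.le⟩, hz t ⟨ht.1.le, ht.2.le⟩]

theorem weightedSq_add_le {γ : ℝ} {g k : Rd d → ℂ} (hg : Measurable g) :
    weightedSq γ (fun ξ => g ξ + k ξ) ≤ 2 * (weightedSq γ g + weightedSq γ k) := by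
  have hm : Measurable fun ξ : Rd d => ‖g ξ‖ₑ ^ 2 * ENNReal.ofReal (symb ξ ^ γ) :=
    (hg.enorm.pow_const 2).mul (continuous_symb_rpow _).measurable.ennreal_ofReal
  simp only [weightedSq]
  rw [← lintegral_add_left hm, ← lintegral_const_mul' _ _ (by simp)]
  refine lintegral_mono fun ξ => ?_
  have h : ‖g ξ + k ξ‖ₑ ^ 2 ≤ 2 * (‖g ξ‖ₑ ^ 2 + ‖k ξ‖ₑ ^ 2) := by
    refine (pow_le_pow_left₀ zero_le (enorm_add_le _ _) 2).trans ?_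
    have := ENNReal.rpow_add_le_mul_rpow_add_rpow ‖g ξ‖ₑ ‖k ξ‖ₑ one_le_two
    norm_num at this
    exact this
  calc _ ≤ 2 * (‖g ξ‖ₑ ^ 2 + ‖k ξ‖ₑ ^ 2) * ENNReal.ofReal (symb ξ ^ γ) := by gcongr
    _ = _ := by ring

theorem MemL2Sobolev.exists_measurable {γ T : ℝ} {g : ℝ → TD d} (h : MemL2Sobolev γ T g) :
    ∃ k : ℝ → Rd d → ℂ, (Measurable fun p : ℝ × Rd d => k p.1 p.2) ∧
      (∀ᵐ t ∂(volume.restrict (Ioo 0 T)), IsFourierDensity (g t) (k t)) ∧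
      ∫⁻ t in Ioo 0 T, weightedSq γ (k t) < ∞ := by
  obtain ⟨⟨k, hk, hg⟩, hfin⟩ := h
  have hl : ∀ᵐ t ∂(volume.restrict (Ioo 0 T)),
      IsFourierDensity (g t) (fun ξ => hk.mk _ (t, ξ)) := by
    filter_upwards [hg, Measure.ae_ae_of_ae_prod hk.ae_eq_mk] with t ht ht'
    exact ht.congr ht'
  refine ⟨fun t ξ => hk.mk _ (t, ξ), hk.measurable_mk, hl, ?_⟩
  rwa [lintegral_congr_ae (hl.mono fun t ht => sobolevSq_eq ht)] at hfin

theorem MemL2Sobolev.add {γ T : ℝ} {g g' : ℝ → TD d} (h : MemL2Sobolev γ T g)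
    (h' : MemL2Sobolev γ T g') : MemL2Sobolev γ T (fun t => g t + g' t) := by
  obtain ⟨k, hk, hd, hfin⟩ := h.exists_measurable
  obtain ⟨l, hl, hd', hfin'⟩ := h'.exists_measurable
  refine memL2Sobolev_of_isFourierDensity (k := fun t ξ => k t ξ + l t ξ) (hk.add hl) ?_ ?_
  · filter_upwards [hd, hd'] with t ht ht' using ht.add ht'
  · refine (lintegral_mono fun t => weightedSq_add_le
      (hk.comp (measurable_const.prodMk measurable_id))).trans_lt ?_
    rw [lintegral_const_mul' _ _ (by simp)]
    refine (congrArg (2 * ·) (lintegral_add_left (measurable_weightedSq hk) _)).trans_lt ?_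
    exact ENNReal.mul_lt_top (by simp) (ENNReal.add_lt_top.mpr ⟨hfin, hfin'⟩)

theorem MemL2Sobolev.smul {γ T : ℝ} {g : ℝ → TD d} (h : MemL2Sobolev γ T g) (c : ℂ) :
    MemL2Sobolev γ T (fun t => c • g t) := by
  obtain ⟨k, hk, hd, hfin⟩ := h.exists_measurable
  refine memL2Sobolev_of_isFourierDensity (k := fun t ξ => c * k t ξ) (hk.const_mul c) ?_ ?_
  · filter_upwards [hd] with t ht using ht.smul c
  · have : ∀ t, weightedSq γ (fun ξ => c * k t ξ) = ‖c‖ₑ ^ 2 * weightedSq γ (k t) := fun t => by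
      simp only [weightedSq, enorm_mul, mul_pow, mul_assoc]
      rw [lintegral_const_mul' _ _ (by simp)]
    simp only [this]
    rw [lintegral_const_mul' _ _ (by simp)]
    exact ENNReal.mul_lt_top (by simp) hfin

theorem memL2Sobolev_zero (γ T : ℝ) : MemL2Sobolev γ T (fun _ => (0 : TD d)) := by
  refine memL2Sobolev_of_isFourierDensity (k := fun _ => 0) measurable_const ?_ ?_
  · exact ae_of_all _ fun _ => isFourierDensity_zero
  · simp [weightedSq]

theorem MemL2Sobolev.sum {γ T : ℝ} {ι : Type*} (s : Finset ι) {g : ι → ℝ → TD d}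
    (h : ∀ i, MemL2Sobolev γ T (g i)) : MemL2Sobolev γ T (fun t => ∑ i ∈ s, g i t) := by
  classical
  induction s using Finset.induction_on with
  | empty => simpa using memL2Sobolev_zero γ T
  | insert i s hi ih => simpa only [Finset.sum_insert hi] using (h i).add ih

theorem memL2Sobolev_laplacian {γ T : ℝ} {v : ℝ → TD d} (h : v ∈ KrylovSpace d γ T) :
    MemL2Sobolev (γ - 2) T (fun t => Δ (v t)) := by
  have h1 := MemL2Sobolev.sum Finset.univ fun i => h.2.1 i i
  refine (congrArg (MemL2Sobolev _ _) (funext fun t => ?_)).mp h1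
  rw [TemperedDistribution.laplacian_eq_sum (EuclideanSpace.basisFun (Fin d) ℝ)]
  simp

/-- Moving the endpoint `t` into an indicator over a fixed interval gives joint measurability. -/
theorem measurable_primitive {T : ℝ} {L : ℝ → Rd d → ℂ}
    (hL : Measurable fun p : ℝ × Rd d => L p.1 p.2) :
    ∃ W : ℝ → Rd d → ℂ, (Measurable fun p : ℝ × Rd d => W p.1 p.2) ∧
      ∀ t ≤ T, ∀ ξ, W t ξ = ∫ s in Ioo 0 t, L s ξ := by
  have h1 : StronglyMeasurable fun q : (ℝ × Rd d) × ℝ =>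
      (Iio q.1.1).indicator (fun s => L s q.1.2) q.2 := by
    refine Measurable.stronglyMeasurable ?_
    have hm : MeasurableSet {q : (ℝ × Rd d) × ℝ | q.2 < q.1.1} :=
      measurableSet_lt measurable_snd (measurable_fst.comp measurable_fst)
    exact (hL.comp (measurable_snd.prodMk (measurable_snd.comp measurable_fst))).indicator hm
  refine ⟨fun t ξ => ∫ s in Ioo 0 T, (Iio t).indicator (fun s => L s ξ) s,
    (h1.integral_prod_right' (ν := volume.restrict (Ioo 0 T))).measurable, fun t ht ξ => ?_⟩
  refine (setIntegral_indicator measurableSet_Iio).trans ?_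
  congr 2
  ext s; simp only [mem_inter_iff, mem_Ioo, mem_Iio]
  exact ⟨fun hs => ⟨hs.1.1, hs.2⟩, fun hs => ⟨⟨hs.1, hs.2.trans_le ht⟩, hs.2⟩⟩

theorem weightedSq_integral_lt_top {γ : ℝ} {μ : Measure ℝ} [IsFiniteMeasure μ]
    {L : ℝ → Rd d → ℂ} (hL : Measurable fun p : ℝ × Rd d => L p.1 p.2)
    (hfin : ∫⁻ s, weightedSq γ (L s) ∂μ < ∞) : weightedSq γ (fun ξ => ∫ s, L s ξ ∂μ) < ∞ := by
  rw [lintegral_weightedSq_eq hL] at hfin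
  refine lt_of_le_of_lt ?_ (ENNReal.mul_lt_top (measure_lt_top μ univ) hfin)
  rw [← lintegral_const_mul' _ _ (measure_ne_top _ _)]
  refine lintegral_mono fun ξ => ?_
  rw [← mul_assoc]
  refine mul_le_mul_left ((pow_le_pow_left₀ zero_le
    (enorm_integral_le_lintegral_enorm _) 2).trans ?_) _
  have := sq_lintegral_mul_le (μ := μ) (f := fun _ => 1) measurable_const
    (measurable_slice hL ξ).enorm
  simpa using this

/-- A distributional solution of the homogeneous heat equation vanishes. -/
theorem eq_zero_of_heat {γ T : ℝ} {u : ℝ → TD d}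
    (hΔ : MemL2Sobolev γ T (fun t => Δ (u t)))
    (heq : ∀ t ∈ Ioo 0 T, ∀ ψ : 𝓢(Rd d, ℂ), HasCompactSupport ψ →
      u t ψ = ∫ s in Ioo 0 t, u s (Δ ψ)) :
    ∀ t ∈ Ioo 0 T, u t = 0 := by
  obtain ⟨L, hL, hLd, hLfin⟩ := hΔ.exists_measurable
  obtain ⟨W, hWm, hW⟩ := measurable_primitive (T := T) hL
  have hW' : ∀ t ∈ Ioo 0 T, W t = fun ξ => ∫ s in Ioo 0 t, L s ξ := fun t ht =>
    funext fun ξ => hW t ht.2.le ξ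
  have hsub : ∀ t ∈ Ioo 0 T, Ioo 0 t ⊆ Ioo 0 T := fun t ht => Ioo_subset_Ioo_right ht.2.le
  have hLfin' : ∀ t ∈ Ioo 0 T, ∫⁻ s in Ioo 0 t, weightedSq γ (L s) < ∞ := fun t ht =>
    (lintegral_mono_set (hsub t ht)).trans_lt hLfin
  -- Nothing is assumed about the transform of `u t` itself. The equation supplies its density as
  -- the time primitive of the transform of `Δu`.
  have hdens : ∀ t ∈ Ioo 0 T, IsDensity (𝓕 (u t)) (W t) := fun t ht => by
    obtain ⟨R, hR⟩ := exists_isDensity (γ := γ) (g := W t)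
      (hWm.comp (measurable_const.prodMk measurable_id)).aestronglyMeasurable (by
        rw [hW' t ht]; exact weightedSq_integral_lt_top hL (hLfin' t ht))
    have hR' : IsDensity (𝓕 (𝓕⁻ R)) (W t) := by rwa [FourierTransform.fourier_fourierInv_eq]
    have : u t = 𝓕⁻ R := ext_of_hasCompactSupport fun ψ hψ => by
      rw [heq t ht ψ hψ, isDensity_fourierInv_apply hR', hW' t ht,
        integral_schwartz_mul_integral hL (hLfin' t ht)]
      refine integral_congr_ae ?_
      filter_upwards [ae_restrict_of_ae_restrict_of_subset (hsub t ht) hLd,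
        ae_lt_top (measurable_weightedSq hL) (hLfin' t ht).ne] with s hs hs'
      rw [← TemperedDistribution.laplacian_apply_apply,
        isDensity_fourierInv_apply (hs.isDensity hs')]
    rwa [this]
  have hLW : ∀ᵐ t ∂(volume.restrict (Ioo 0 T)), ∀ᵐ ξ, L t ξ = -(lapSymb ξ : ℂ) * W t ξ := by
    filter_upwards [hLd, ae_restrict_mem measurableSet_Ioo] with t ht ht'
    exact ht.ae_eq (hdens t ht').isFourierDensity.laplacian
  have hms : MeasurableSet {p : ℝ × Rd d | L p.1 p.2 = -(lapSymb p.2 : ℂ) * W p.1 p.2} :=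
    measurableSet_eq_fun hL (measurable_lapSymb_mul hWm)
  -- Exchanging the quantifiers "almost every `t`" and "almost every `ξ`" leaves a scalar ODE at
  -- almost every `ξ`. The exceptional set of `ξ` does not depend on `t`, so `u t` vanishes at every
  -- time.
  have hξ : ∀ᵐ ξ : Rd d, ∀ t ∈ Ioo 0 T, W t ξ = 0 := by
    filter_upwards [(Measure.ae_ae_comm hms).mp hLW, ae_integrable_slice hL hLfin] with ξ h1 h2
    intro t ht
    rw [hW t ht.2.le]
    refine eq_zero_of_ae_eq_mul_primitive (a := lapSymb ξ) h2 ?_ t ht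
    filter_upwards [h1, ae_restrict_mem measurableSet_Ioo] with s hs hs'
    rw [hs, hW s hs'.2.le]
  intro t ht
  have h0 : W t =ᵐ[volume] 0 := hξ.mono fun ξ h => h t ht
  refine ext_of_hasCompactSupport fun ψ _ => ?_
  rw [isDensity_fourierInv_apply ((hdens t ht).congr h0)]
  simp

/-- The difference solves the homogeneous equation. Time `0` is covered by the initial condition;
time `T` is excluded because the equation is imposed only on the open interval. -/
theorem IsSolution.eq_of_mem_krylovSpace {γ T : ℝ} {v w g : ℝ → TD d} (hv : v ∈ KrylovSpace d γ T)
    (hw : w ∈ KrylovSpace d γ T) (hvg : IsSolution T v g) (hwg : IsSolution T w g) :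
    ∀ t ∈ Ico 0 T, w t = v t := by
  obtain ⟨-, hv0, hve⟩ := hvg
  obtain ⟨-, hw0, hwe⟩ := hwg
  intro t ht
  rcases ht.1.eq_or_lt with rfl | ht0
  · rw [hv0, hw0]
  rw [← sub_eq_zero]
  refine eq_zero_of_heat (γ := γ - 2) (u := fun t => w t - v t) ?_
    (fun s hs ψ hψ => ?_) t ⟨ht0, ht.2⟩
  · have h1 := (memL2Sobolev_laplacian hw).add ((memL2Sobolev_laplacian hv).smul (-1))
    refine (congrArg (MemL2Sobolev _ _) (funext fun s => ?_)).mp h1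
    ext ψ
    simp [sub_eq_add_neg]
  · obtain ⟨h1, h2, h3⟩ := hve s hs ψ hψ
    obtain ⟨h1', h2', h3'⟩ := hwe s hs ψ hψ
    have e : ∀ (r : ℝ) (χ : 𝓢(Rd d, ℂ)), (w r - v r) χ = w r χ - v r χ := fun _ _ => rfl
    simp only [e]
    rw [integral_sub h1' h1, h3, h3']
    ring

/-- The heat equation with right-hand side `(1-Δ)^{-α/2} φ` is solved by `h`. -/
theorem exists_hFun_solution {α T : ℝ} {Ω : Type*} [MeasurableSpace Ω] {P : Measure Ω}
    {F : 𝓓(strip d T, ℝ) → Ω → ℝ} (hF : IsGaussianNoise (besselKernel d α) T P F) (hα : 0 < α)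
    (hd : (d : ℝ) - 2 < α) (hT : 0 ≤ T) {φ : ℝ → TD d} (hφ : φ ∈ PZero d α T) :
    ∃ h : ℝ → TD d, (∀ t ∈ Icc 0 T, IsDensity (h t) (fun x => (hFun α T P F φ t x : ℂ))) ∧
      h ∈ KrylovSpace d (α / 2 + 2) T ∧
      IsSolution T h (fun t => oneSubLaplacianPow (-α) (φ t)) := by
  obtain ⟨k', hk'⟩ := isApproximable_of_mem_PZero hα hφ
  obtain ⟨k, hkm, hk⟩ := hk'.exists_measurable
  have hK : Measurable fun p : ℝ × Rd d => potential α k p.1 p.2 :=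
    ((continuous_symb_rpow_ofReal (-α / 2)).measurable.comp measurable_snd).mul hkm
  have hfin : ∫⁻ t in Icc 0 T, weightedSq (α / 2) (potential α k t) < ∞ := by
    -- The operator `(1-Δ)^{-α/2}` gains `α` derivatives, taking order `-α/2` to order `α/2`.
    have h1 : ∀ t, weightedSq (α / 2) (potential α k t) ≤ weightedSq (-α / 2) (k t) := fun t => by
      refine weightedSq_const_mul_le fun ξ => le_of_eq ?_
      have h2 : symb ξ ^ (-α / 2) * symb ξ ^ (α / 2) = 1 := by
        rw [← Real.rpow_add (symb_pos ξ)]; simp [neg_div]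
      rw [potential, norm_mul, Complex.norm_real,
        Real.norm_of_nonneg (Real.rpow_nonneg (symb_pos ξ).le _)]
      linear_combination (‖k t ξ‖ ^ 2 * symb ξ ^ (-α / 2)) * h2
    refine (lintegral_mono h1).trans_lt ?_
    rw [← sq_eLpNorm_wtd hkm.aemeasurable]
    exact ENNReal.pow_lt_top hk.memLp.2
  have hg : ∀ᵐ t ∂(volume.restrict (Icc 0 T)),
      IsFourierDensity (oneSubLaplacianPow (-α) (φ t)) (potential α k t) := by
    filter_upwards [hk.rep.density] with t ht using ht.oneSubLaplacianPow (-α)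
  -- Integrability of the Duhamel integral gives one distribution with both densities: its transform
  -- satisfies the heat equation, and its own density is `hFun`. Outside `[0,T]` any value will do.
  have hex : ∀ t, ∃ S : TD d, t ∈ Icc 0 T → IsDensity (𝓕 S) (duhamel T (potential α k) t) ∧
      IsDensity S (𝓕⁻ (duhamel T (potential α k) t)) := fun t => by
    by_cases ht : t ∈ Icc 0 T
    · obtain ⟨S, hS⟩ := exists_fourier_isDensity_of_integrable
        (integrable_duhamel hα hd ht.2 hk)
      exact ⟨S, fun _ => hS⟩
    · exact ⟨0, fun h => absurd h ht⟩
  choose h hh using hex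
  have hv : ∀ t ∈ Icc 0 T, IsFourierDensity (h t) (duhamel T (potential α k) t) := fun t ht =>
    (hh t ht).1.isFourierDensity
  refine ⟨h, fun t ht => ?_, mem_krylovSpace_of_duhamel hK hfin hT hv hg,
    isSolution_of_duhamel hK hfin hT hv hg⟩
  refine (congrArg (IsDensity (h t)) (funext fun x => ?_)).mp (hh t ht).2
  exact (hFun_eq_fourierInv hF hα hd ht.2 hk x).symm

end BesselHeat

end

/-! ### The theorem -/

open BesselHeat in
theorem theorem4p4 (d : ℕ) (hd : 1 ≤ d) (α T : ℝ) (hα : 0 < α) (hαd : (d : ℝ) - 2 < α)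
    (hT : 0 < T) {Ω : Type*} [MeasurableSpace Ω] (P : Measure Ω) [IsProbabilityMeasure P]
    (F : 𝓓(strip d T, ℝ) → Ω → ℝ) (hF : IsGaussianNoise (besselKernel d α) T P F)
    (φ : ℝ → TD d) (hφ : φ ∈ PZero d α T) :
    ∃ h : ℝ → TD d,
      (∀ t ∈ Icc 0 T, IsDensity (h t) (fun x => (hFun α T P F φ t x : ℂ))) ∧
      h ∈ KrylovSpace d (α / 2 + 2) T ∧
      IsSolution T h (fun t => oneSubLaplacianPow (-α) (φ t)) ∧
      ∀ w ∈ KrylovSpace d (α / 2 + 2) T,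
        IsSolution T w (fun t => oneSubLaplacianPow (-α) (φ t)) →
          ∀ t ∈ Ico 0 T, w t = h t := by
  obtain ⟨h, hdens, hmem, hsol⟩ := exists_hFun_solution hF hα hαd hT.le hφ
  exact ⟨h, hdens, hmem, hsol, fun w hw hwsol => hsol.eq_of_mem_krylovSpace hmem hw hwsol⟩
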